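/- **Setting.** Let $p,q,n\ge 1$, let $\Theta^0\in\mathbb R^{q\times p}$, $\Theta^0\neq 0$, let $\Lambda^0\in\mathbb R^{p\times p}$ and $\Sigma^0_{xx}\in\mathbb R^{q\times q}$ be symmetric positive definite, and put $B^0=-(\Lambda^0)^{-1}(\Theta^0)^T$. Let $(X_i,Y_i)_{i\le n}$ be an i.i.d. centred sub-Gaussian sample in $\mathbb R^q\times\mathbb R^p$ such that $X_i$ has covariance $\Sigma^0_{xx}$ and $Y_i$ given $X_i$ has mean $B^0X_i$ and covariance $(\Lambda^0)^{-1}$. Put $S_{xx}=\frac1n\sum_i X_iX_i^T$, $S_{xy}=\frac1n\sum_i X_iY_i^T$, $S_{yy}=\frac1n\sum_i Y_iY_i^T$ and $$l(\Theta,\Lambda)=\tfrac n2\Big(\log\det\Lambda-\mathrm{tr}\big(S_{yy}\Lambda+2S_{xy}^T\Theta+\Lambda^{-1}\Theta^TS_{xx}\Theta\big)\Big).$$ For $0<\nu_0\le\nu_1$ and $\rho,\eta\in[0,1]$ let $LP(t,\nu)=\frac1{2\nu}e^{-|t|/\nu}$, $f(t)=\eta LP(t,\nu_1)+(1-\eta)LP(t,\nu_0)$,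 and $$\Pi(\Theta)=\prod_i\Big[\rho\prod_j f(\Theta_{ij})+(1-\rho)\prod_j LP(\Theta_{ij},\nu_0)\Big],\qquad \Pi(\Lambda)=\prod_{i<j}f(\Lambda_{ij}),$$ $L(\Theta,\Lambda)=-l(\Theta,\Lambda)-\log\Pi(\Theta)-\log\Pi(\Lambda)$. For $R\in\mathbb R$ let $HPD$ be the set of all $(\Theta,\Lambda)$ with $\Lambda$ symmetric positive definite, $\|\Lambda\|_2<R$ (spectral norm) and $L(\Theta,\Lambda)\le L(\Theta^0,\Lambda^0)$. **Constants.** Let $|S^0_{row}|=\#\{(i,j):\Theta^0_{i\cdot}\ne0\}+\#\{(i,j):\Lambda^0_{ij}\neq0\}$, $T=\lambda_{max}[(\Theta^0)^T\Sigma^0_{xx}\Theta^0]$, $\rho_1=0.5\min(\lambda_{max}(\Lambda^0)^{-1},\lambda_{min}(\Sigma^0_{xx}))$, $\rho_2=1.5\,\lambda_{max}(\Sigma^0_{xx})$, $\alpha=1+2\nu_1/\nu_0$, $s_0=|S^0_{row}|+\lceil4(\rho_2/\rho_1)\alpha^2|S^0_{row}|\rceil$, $r_0=\min[0.5\lambda_{min}(\Lambda^0),\,0.13\sqrt{T/\rho_2}]$,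 $$\beta_0=\frac{\rho_1}{40\lambda_{max}(\Lambda^0)}\min\Big[1,\frac{\lambda_{min}(3\Lambda^0)}{16\,T}\Big],\qquad \epsilon_n=\frac{C}{\beta_0}\sqrt{\frac{|S^0_{row}|\log(p+q)}{n}},$$ $F_\Lambda=\|(\Lambda^0)^{-1}\|_F$ and $F_\Theta=\|\Theta^0\|_F$. **Conditions on the data.** (a) for all $u\neq0$ in $\mathbb R^q$ with at most $s_0$ nonzero entries, $0.5\le \frac{u^TS_{xx}u}{u^T\Sigma^0_{xx}u}\le1.5$; and $\lambda_{max}[(\Theta^0)^TS_{xx}\Theta^0]\le1.4\,T$; (i) $1/\nu_1>2\|\nabla l(\Theta^0,\Lambda^0)\|_\infty$, the largest absolute value of a partial derivative of $l$ in an entry of $\Theta$ or $\Lambda$ at $(\Theta^0,\Lambda^0)$. **Statement.** For all $K_0,K_1>0$ there is a constant $C>0$, depending only on $K_0,K_1$, such that in every setting as above the following holds. Assume that $\frac1{n\nu_0}\le K_0\sqrt{\log(p+q)/n}$, $\frac1{n\nu_1}\le K_1\sqrt{\log(p+q)/n}$, that $R<2\lambda_{max}(\Lambda^0)\sqrt{r_0}/\epsilon_n$,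 that $n>(p+s_0)\log(p+q)/\varepsilon_1$ for some $\varepsilon_1\in(0,1)$, and that $F_\Lambda\epsilon_n<1$. Let $\epsilon_0\in(0,1)$, and let $\mathcal G$ be the event that, for every $(\Theta,\Lambda)\in HPD$, the matrix $B=-\Lambda^{-1}\Theta^T$ satisfies $$\|B-B^0\|_F\le\frac{F_\Lambda\epsilon_n}{1-F_\Lambda\epsilon_n}\,(1+F_\Lambda F_\Theta).$$ If the conditions (a) and (i) on the data hold with probability greater than $1-\epsilon_0$, then $\mathcal G$ has probability greater than $1-\epsilon_0$. Moreover, whenever the conditions (a) and (i) hold with positive probability, $\mathcal G$ has conditional probability greater than $1-\epsilon_0$ given that they hold. -/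

import Mathlib

open MeasureTheory ProbabilityTheory Matrix
open scoped NNReal ENNReal

noncomputable section

namespace GCRF

/-! ### Matrix notions -/

/-- Frobenius norm. -/
def frob {a b : ℕ} (A : Matrix (Fin a) (Fin b) ℝ) : ℝ :=
  Real.sqrt (∑ i, ∑ j, A i j ^ 2)

/-- Elementwise maximum norm `max |A i j|`. -/
def maxNorm {a b : ℕ} (A : Matrix (Fin a) (Fin b) ℝ) : ℝ :=
  ⨆ ij : Fin a × Fin b, |A ij.1 ij.2|

/-- Largest eigenvalue of a (symmetric) matrix. -/
def lamMax {a : ℕ} (A : Matrix (Fin a) (Fin a) ℝ) : ℝ := sSup (spectrum ℝ A)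

/-- Smallest eigenvalue of a (symmetric) matrix. -/
def lamMin {a : ℕ} (A : Matrix (Fin a) (Fin a) ℝ) : ℝ := sInf (spectrum ℝ A)

/-- Spectral norm: the operator norm for the Euclidean norms. -/
def specNorm {a : ℕ} (A : Matrix (Fin a) (Fin a) ℝ) : ℝ :=
  ‖Matrix.toEuclideanCLM (𝕜 := ℝ) A‖

/-- The regression coefficient matrix `B = -Λ⁻¹ Θᵀ`. -/
def coefB {p q : ℕ} (Θ : Matrix (Fin q) (Fin p) ℝ) (Λ : Matrix (Fin p) (Fin p) ℝ) :
    Matrix (Fin p) (Fin q) ℝ :=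
  -(Λ⁻¹ * Θᵀ)

/-! ### Likelihood, prior and posterior -/

/-- Empirical second-moment matrix `(1/n) ∑ᵢ xᵢ yᵢᵀ`. -/
def empMoment {n a b : ℕ} (x : Fin n → Fin a → ℝ) (y : Fin n → Fin b → ℝ) :
    Matrix (Fin a) (Fin b) ℝ :=
  (1 / (n : ℝ)) • ∑ i, Matrix.vecMulVec (x i) (y i)

/-- The log-likelihood of the Gaussian conditional random field for the observations
`(xᵢ, yᵢ)`, `i < n` (up to an additive constant). -/
def logLik {n p q : ℕ} (x : Fin n → Fin q → ℝ) (y : Fin n → Fin p → ℝ)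
    (Θ : Matrix (Fin q) (Fin p) ℝ) (Λ : Matrix (Fin p) (Fin p) ℝ) : ℝ :=
  (n : ℝ) / 2 * (Real.log Λ.det -
    Matrix.trace (empMoment y y * Λ + (2 : ℝ) • ((empMoment x y)ᵀ * Θ)
      + Λ⁻¹ * Θᵀ * empMoment x x * Θ))

/-- The partial derivatives of the log-likelihood in the entries of `Θ`. -/
def gradTheta {n p q : ℕ} (x : Fin n → Fin q → ℝ) (y : Fin n → Fin p → ℝ)
    (Θ : Matrix (Fin q) (Fin p) ℝ) (Λ : Matrix (Fin p) (Fin p) ℝ) :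
    Matrix (Fin q) (Fin p) ℝ :=
  Matrix.of fun i j => deriv (fun t : ℝ => logLik x y (Θ + t • Matrix.single i j (1 : ℝ)) Λ) 0

/-- The partial derivatives of the log-likelihood in the entries of `Λ`. -/
def gradLambda {n p q : ℕ} (x : Fin n → Fin q → ℝ) (y : Fin n → Fin p → ℝ)
    (Θ : Matrix (Fin q) (Fin p) ℝ) (Λ : Matrix (Fin p) (Fin p) ℝ) :
    Matrix (Fin p) (Fin p) ℝ :=
  Matrix.of fun i j => deriv (fun t : ℝ => logLik x y Θ (Λ + t • Matrix.single i j (1 : ℝ))) 0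

/-- The elementwise maximum norm of the gradient of the log-likelihood. -/
def gradNorm {n p q : ℕ} (x : Fin n → Fin q → ℝ) (y : Fin n → Fin p → ℝ)
    (Θ : Matrix (Fin q) (Fin p) ℝ) (Λ : Matrix (Fin p) (Fin p) ℝ) : ℝ :=
  max (maxNorm (gradTheta x y Θ Λ)) (maxNorm (gradLambda x y Θ Λ))

/-- Laplace density with scale `ν`. -/
def laplace (φ ν : ℝ) : ℝ := 1 / (2 * ν) * Real.exp (-(|φ| / ν))

/-- The elementwise spike (scale `ν₀`) and slab (scale `ν₁`) density. -/
def spikeSlab (η ν₀ ν₁ φ : ℝ) : ℝ := η * laplace φ ν₁ + (1 - η) * laplace φ ν₀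

/-- Prior density of `Θ`: each row is, with weight `ρ`, a product of spike-and-slab densities
and, with weight `1 - ρ`, a product of spike densities. -/
def priorTheta {p q : ℕ} (ρ η ν₀ ν₁ : ℝ) (Θ : Matrix (Fin q) (Fin p) ℝ) : ℝ :=
  ∏ i, (ρ * ∏ j, spikeSlab η ν₀ ν₁ (Θ i j) + (1 - ρ) * ∏ j, laplace (Θ i j) ν₀)

/-- Prior density of `Λ`: product over `i < j` (the diagonal has a uniform prior, which
contributes a constant). -/
def priorLambda {p : ℕ} (η ν₀ ν₁ : ℝ) (Λ : Matrix (Fin p) (Fin p) ℝ) : ℝ :=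
  ∏ i, ∏ j ∈ Finset.Ioi i, spikeSlab η ν₀ ν₁ (Λ i j)

/-- Negative log-posterior, up to an additive constant. -/
def negLogPost {n p q : ℕ} (ρ η ν₀ ν₁ : ℝ) (x : Fin n → Fin q → ℝ) (y : Fin n → Fin p → ℝ)
    (Θ : Matrix (Fin q) (Fin p) ℝ) (Λ : Matrix (Fin p) (Fin p) ℝ) : ℝ :=
  -logLik x y Θ Λ + -Real.log (priorTheta ρ η ν₀ ν₁ Θ) + -Real.log (priorLambda η ν₀ ν₁ Λ)

/-- The high posterior density region: the parameters (`Λ` positive definite with spectral norm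
less than `R`) whose posterior density is at least the one of the true parameter. -/
def HPD {n p q : ℕ} (ρ η ν₀ ν₁ R : ℝ) (x : Fin n → Fin q → ℝ) (y : Fin n → Fin p → ℝ)
    (Θ₀ : Matrix (Fin q) (Fin p) ℝ) (Λ₀ : Matrix (Fin p) (Fin p) ℝ) :
    Set (Matrix (Fin q) (Fin p) ℝ × Matrix (Fin p) (Fin p) ℝ) :=
  {Φ | Φ.2.PosDef ∧ specNorm Φ.2 < R ∧
    negLogPost ρ η ν₀ ν₁ x y Φ.1 Φ.2 ≤ negLogPost ρ η ν₀ ν₁ x y Θ₀ Λ₀}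

/-! ### The constants of the theory -/

/-- `|S⁰_row|`: the number of entries of `Θ₀` in nonzero rows plus the number of nonzero entries
of `Λ₀`. -/
def sRow {p q : ℕ} (Θ₀ : Matrix (Fin q) (Fin p) ℝ) (Λ₀ : Matrix (Fin p) (Fin p) ℝ) : ℕ :=
  {ij : Fin q × Fin p | ∃ k, Θ₀ ij.1 k ≠ 0}.ncard
    + {ij : Fin p × Fin p | Λ₀ ij.1 ij.2 ≠ 0}.ncard

/-- `λ_max(Θ₀ᵀ M Θ₀)`. -/
def lamTheta {p q : ℕ} (M : Matrix (Fin q) (Fin q) ℝ) (Θ₀ : Matrix (Fin q) (Fin p) ℝ) : ℝ :=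
  lamMax (Θ₀ᵀ * M * Θ₀)

def rhoOne {p q : ℕ} (Sig : Matrix (Fin q) (Fin q) ℝ) (Λ₀ : Matrix (Fin p) (Fin p) ℝ) : ℝ :=
  0.5 * min (lamMax Λ₀)⁻¹ (lamMin Sig)

def rhoTwo {q : ℕ} (Sig : Matrix (Fin q) (Fin q) ℝ) : ℝ := 1.5 * lamMax Sig

/-- `α = 1 + 2 ν₁ / ν₀`. -/
def coneAlpha (ν₀ ν₁ : ℝ) : ℝ := 1 + 2 * ν₁ / ν₀

/-- The sparsity level `s₀` of the restricted isometry condition. -/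
def sZero {p q : ℕ} (ν₀ ν₁ : ℝ) (Sig : Matrix (Fin q) (Fin q) ℝ)
    (Θ₀ : Matrix (Fin q) (Fin p) ℝ) (Λ₀ : Matrix (Fin p) (Fin p) ℝ) : ℕ :=
  sRow Θ₀ Λ₀ +
    ⌈4 * (rhoTwo Sig / rhoOne Sig Λ₀) * coneAlpha ν₀ ν₁ ^ 2 * (sRow Θ₀ Λ₀ : ℝ)⌉₊

def rZero {p q : ℕ} (Sig : Matrix (Fin q) (Fin q) ℝ)
    (Θ₀ : Matrix (Fin q) (Fin p) ℝ) (Λ₀ : Matrix (Fin p) (Fin p) ℝ) : ℝ :=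
  min (0.5 * lamMin Λ₀) (0.13 * Real.sqrt (lamTheta Sig Θ₀ / rhoTwo Sig))

def betaZero {p q : ℕ} (Sig : Matrix (Fin q) (Fin q) ℝ)
    (Θ₀ : Matrix (Fin q) (Fin p) ℝ) (Λ₀ : Matrix (Fin p) (Fin p) ℝ) : ℝ :=
  rhoOne Sig Λ₀ / (40 * lamMax Λ₀) *
    min 1 (lamMin ((3 : ℝ) • Λ₀) / (16 * lamTheta Sig Θ₀))

/-- The rate `ε_n = (C / β₀) √(|S⁰_row| log(p + q) / n)`. -/
def epsRate {p q : ℕ} (C : ℝ) (n : ℕ) (Sig : Matrix (Fin q) (Fin q) ℝ)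
    (Θ₀ : Matrix (Fin q) (Fin p) ℝ) (Λ₀ : Matrix (Fin p) (Fin p) ℝ) : ℝ :=
  C / betaZero Sig Θ₀ Λ₀ *
    Real.sqrt ((sRow Θ₀ Λ₀ : ℝ) * Real.log ((p : ℝ) + (q : ℝ)) / (n : ℝ))

/-! ### Conditions on the data, and the sampling model -/

/-- The `s`-sparse restricted isometry condition on the design `x`. -/
def RestrictedIsometry {n p q : ℕ} (s : ℕ) (x : Fin n → Fin q → ℝ)
    (Sig : Matrix (Fin q) (Fin q) ℝ) (Θ₀ : Matrix (Fin q) (Fin p) ℝ) : Prop :=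
  (∀ u : Fin q → ℝ, u ≠ 0 → {k | u k ≠ 0}.ncard ≤ s →
    0.5 ≤ (u ⬝ᵥ (empMoment x x *ᵥ u)) / (u ⬝ᵥ (Sig *ᵥ u)) ∧
    (u ⬝ᵥ (empMoment x x *ᵥ u)) / (u ⬝ᵥ (Sig *ᵥ u)) ≤ 1.5) ∧
  lamTheta (empMoment x x) Θ₀ / lamTheta Sig Θ₀ ≤ 1.4

/-- The conditions that involve the realised data: restricted isometry at level `s₀`, and
`1 / ν₁ > 2 ‖∇l(Θ₀, Λ₀)‖_∞`. -/
def DataConditions {n p q : ℕ} (ν₀ ν₁ : ℝ) (x : Fin n → Fin q → ℝ) (y : Fin n → Fin p → ℝ)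
    (Sig : Matrix (Fin q) (Fin q) ℝ)
    (Θ₀ : Matrix (Fin q) (Fin p) ℝ) (Λ₀ : Matrix (Fin p) (Fin p) ℝ) : Prop :=
  RestrictedIsometry (sZero ν₀ ν₁ Sig Θ₀ Λ₀) x Sig Θ₀ ∧ 2 * gradNorm x y Θ₀ Λ₀ < 1 / ν₁

/-- `(Xᵢ, Yᵢ)`, `i < n`, is an i.i.d. sub-Gaussian (in particular centred) sample such that `Xᵢ`
has covariance `Sig` and, given `Xᵢ`, the response `Yᵢ` has mean `B⁰ Xᵢ`, `B⁰ = -Λ₀⁻¹ Θ₀ᵀ`, and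
covariance `Λ₀⁻¹`. This holds when `Yᵢ` given `Xᵢ` follows the Gaussian conditional random field
with parameters `(Θ₀, Λ₀)` and `Xᵢ` is sub-Gaussian with covariance `Sig`. -/
structure IsSample {Ω : Type*} [MeasurableSpace Ω] (μ : Measure Ω) {n p q : ℕ}
    (X : Fin n → Ω → Fin q → ℝ) (Y : Fin n → Ω → Fin p → ℝ)
    (Sig : Matrix (Fin q) (Fin q) ℝ)
    (Θ₀ : Matrix (Fin q) (Fin p) ℝ) (Λ₀ : Matrix (Fin p) (Fin p) ℝ) : Prop where
  measurable_X : ∀ i, Measurable (X i)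
  measurable_Y : ∀ i, Measurable (Y i)
  indep : iIndepFun (fun i ω => (X i ω, Y i ω)) μ
  identDistrib : ∀ i j,
    IdentDistrib (fun ω => (X i ω, Y i ω)) (fun ω => (X j ω, Y j ω)) μ μ
  subGaussian : ∃ c : ℝ≥0, ∀ i (u : Fin q → ℝ) (v : Fin p → ℝ),
    HasSubgaussianMGF (fun ω => u ⬝ᵥ X i ω + v ⬝ᵥ Y i ω)
      (c * Real.toNNReal (u ⬝ᵥ u + v ⬝ᵥ v)) μ
  cov_X : ∀ i j k, ∫ ω, X i ω j * X i ω k ∂μ = Sig j k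
  condMean : ∀ i k,
    μ[fun ω => Y i ω k | MeasurableSpace.comap (X i) inferInstance]
      =ᵐ[μ] fun ω => (coefB Θ₀ Λ₀ *ᵥ X i ω) k
  condCov : ∀ i k l,
    μ[fun ω => (Y i ω - coefB Θ₀ Λ₀ *ᵥ X i ω) k * (Y i ω - coefB Θ₀ Λ₀ *ᵥ X i ω) l
        | MeasurableSpace.comap (X i) inferInstance]
      =ᵐ[μ] fun _ => Λ₀⁻¹ k l

/-- The bound for the plug-in estimator holds at every point of the HPD region. -/
def PlugInBound {n p q : ℕ} (ρ η ν₀ ν₁ R ε : ℝ) (x : Fin n → Fin q → ℝ) (y : Fin n → Fin p → ℝ)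
    (Θ₀ : Matrix (Fin q) (Fin p) ℝ) (Λ₀ : Matrix (Fin p) (Fin p) ℝ) : Prop :=
  ∀ Φ ∈ HPD ρ η ν₀ ν₁ R x y Θ₀ Λ₀,
    frob (coefB Φ.1 Φ.2 - coefB Θ₀ Λ₀) ≤
      frob Λ₀⁻¹ * ε / (1 - frob Λ₀⁻¹ * ε) * (1 + frob Λ₀⁻¹ * frob Θ₀)

end GCRF

end

/-!
The bound is deterministic: it holds at every sample point where the conditions on the data do.

*Likelihood.* The remainder of the first-order expansion of `l` at `(Θ₀, Λ₀)` has a closed form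
(`logLik_remainder`): it is `n / 2` times the divergence
`log det Λ₀ - log det Λ + tr (Λ₀⁻¹ (Λ - Λ₀)) + tr (Λ⁻¹ Eᵀ S_xx E)`, `E = Θ - Θ₀ Λ₀⁻¹ Λ`.
Diagonalising `Λ₀` and `Λ` by one congruence turns the first part into `∑ (dᵢ - 1 - log dᵢ)` and
the second into a weighted sum of squares, and both are at least `1 / V` times a quadratic form in
`(Θ - Θ₀, Λ - Λ₀)`, where `V = 1 + ‖Λ₀⁻¹‖_F ‖Λ - Λ₀‖_F` bounds all `dᵢ`
(`exists_le_likDiv`). The growth is thus quadratic everywhere, up to the factor `V`, which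
`‖Λ₀⁻¹‖_F ε_n < 1` absorbs in the end.

*Prior.* Moving an entry by `d` multiplies the prior by at most `exp (|d| / ν₀)` on the support and
by at most `exp (-|d| / ν₁)` off it. With `2 ‖∇l‖_∞ < 1 / ν₁`, a point of higher posterior density
than the truth satisfies `likDiv_le_of_negLogPost_le`. As the divergence is nonnegative, the
deviation lies in a cone where `Θ - Θ₀` is nearly supported on the nonzero rows of `Θ₀`; and the
divergence is at most a constant times `√(|S⁰_row| log (p + q) / n)` times the norm of the
deviation.

*Design.* On that cone the restricted isometry condition bounds `tr ((Θ - Θ₀)ᵀ S_xx (Θ - Θ₀))`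
from below. The columns of `Θ - Θ₀` are cut into blocks of decreasing size of the entries
(`norm_mulVec_le_of_bounded`, `le_frob_mul_of_sparse`).

Comparing the two bounds gives `‖Θ - Θ₀‖_F, ‖Λ - Λ₀‖_F ≤ ε_n` (`frob_sub_le_epsRate`), and a
perturbation bound for the inverse gives the claim for `B = -Λ⁻¹ Θᵀ` (`frob_coefB_sub_le`).
-/

namespace GCRF

variable {a b c n p q : ℕ}

/-! ### The Frobenius norm -/

lemma frob_nonneg (A : Matrix (Fin a) (Fin b) ℝ) : 0 ≤ frob A := Real.sqrt_nonneg _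

lemma frob_sq (A : Matrix (Fin a) (Fin b) ℝ) : frob A ^ 2 = ∑ i, ∑ j, A i j ^ 2 :=
  Real.sq_sqrt (Finset.sum_nonneg fun _ _ => Finset.sum_nonneg fun _ _ => sq_nonneg _)

attribute [local instance] Matrix.frobeniusNormedAddCommGroup in
lemma frob_eq_norm (A : Matrix (Fin a) (Fin b) ℝ) : frob A = ‖A‖ := by
  rw [Matrix.frobenius_norm_def, frob, Real.sqrt_eq_rpow]
  simp

attribute [local instance] Matrix.frobeniusNormedAddCommGroup in
lemma frob_add_le (A B : Matrix (Fin a) (Fin b) ℝ) : frob (A + B) ≤ frob A + frob B := by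
  simpa only [frob_eq_norm] using norm_add_le A B

attribute [local instance] Matrix.frobeniusNormedAddCommGroup in
lemma frob_neg (A : Matrix (Fin a) (Fin b) ℝ) : frob (-A) = frob A := by
  simp only [frob_eq_norm, norm_neg]

lemma frob_sub_le (A B : Matrix (Fin a) (Fin b) ℝ) : frob (A - B) ≤ frob A + frob B := by
  simpa [sub_eq_add_neg, frob_neg] using frob_add_le A (-B)

lemma le_frob_add (A B : Matrix (Fin a) (Fin b) ℝ) : frob A - frob B ≤ frob (A + B) := by
  have := frob_sub_le (A + B) B
  rw [add_sub_cancel_right] at this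
  linarith

attribute [local instance] Matrix.frobeniusNormedAddCommGroup in
lemma frob_mul_le (A : Matrix (Fin a) (Fin b) ℝ) (B : Matrix (Fin b) (Fin c) ℝ) :
    frob (A * B) ≤ frob A * frob B := by
  simpa only [frob_eq_norm] using Matrix.frobenius_norm_mul A B

lemma frob_transpose (A : Matrix (Fin a) (Fin b) ℝ) : frob Aᵀ = frob A := by
  rw [frob, frob, Finset.sum_comm]
  rfl

lemma trace_transpose_mul_self (A : Matrix (Fin a) (Fin b) ℝ) : (Aᵀ * A).trace = frob A ^ 2 := by
  rw [frob_sq, Finset.sum_comm]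
  simp [Matrix.trace, Matrix.mul_apply, sq]

lemma trace_transpose_mul_le (A B : Matrix (Fin a) (Fin b) ℝ) :
    (Aᵀ * B).trace ≤ frob A * frob B := by
  have h := Finset.sum_mul_sq_le_sq_mul_sq (Finset.univ : Finset (Fin a × Fin b))
    (fun ij => A ij.1 ij.2) (fun ij => B ij.1 ij.2)
  simp only [Fintype.sum_prod_type] at h
  rw [← frob_sq, ← frob_sq, ← mul_pow] at h
  have h2 : (Aᵀ * B).trace = ∑ i, ∑ j, A i j * B i j := by
    rw [Finset.sum_comm]
    simp [Matrix.trace, Matrix.mul_apply]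
  rw [h2]
  exact abs_le_of_sq_le_sq' h (mul_nonneg (frob_nonneg _) (frob_nonneg _)) |>.2

lemma abs_apply_le_frob (A : Matrix (Fin a) (Fin b) ℝ) (i : Fin a) (j : Fin b) :
    |A i j| ≤ frob A := by
  refine abs_le_of_sq_le_sq ?_ (frob_nonneg _)
  rw [frob_sq]
  calc A i j ^ 2 ≤ ∑ j, A i j ^ 2 :=
        Finset.single_le_sum (f := fun j => A i j ^ 2) (fun _ _ => sq_nonneg _)
          (Finset.mem_univ j)
    _ ≤ ∑ i, ∑ j, A i j ^ 2 :=
        Finset.single_le_sum (f := fun i => ∑ j, A i j ^ 2)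
          (fun _ _ => Finset.sum_nonneg fun _ _ => sq_nonneg _) (Finset.mem_univ i)

lemma frob_sq_eq_sum_col (A : Matrix (Fin a) (Fin b) ℝ) :
    frob A ^ 2 = ∑ j, (A.col j) ⬝ᵥ (A.col j) := by
  rw [frob_sq, Finset.sum_comm]
  simp [dotProduct, sq]

lemma frob_mul_sq_eq_sum_col (A : Matrix (Fin a) (Fin b) ℝ) (X : Matrix (Fin b) (Fin c) ℝ) :
    frob (A * X) ^ 2 = ∑ j, (A *ᵥ X.col j) ⬝ᵥ (A *ᵥ X.col j) := by
  rw [frob_sq_eq_sum_col]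
  rfl

/-- A bound for a quadratic form passes from vectors to matrices, column by column. -/
lemma frob_mul_sq_le {A : Matrix (Fin a) (Fin b) ℝ} {k : ℝ}
    (h : ∀ x, (A *ᵥ x) ⬝ᵥ (A *ᵥ x) ≤ k * (x ⬝ᵥ x)) (X : Matrix (Fin b) (Fin c) ℝ) :
    frob (A * X) ^ 2 ≤ k * frob X ^ 2 := by
  rw [frob_mul_sq_eq_sum_col, frob_sq_eq_sum_col, Finset.mul_sum]
  exact Finset.sum_le_sum fun j _ => h _

lemma le_frob_mul_sq {A : Matrix (Fin a) (Fin b) ℝ} {k : ℝ}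
    (h : ∀ x, k * (x ⬝ᵥ x) ≤ (A *ᵥ x) ⬝ᵥ (A *ᵥ x)) (X : Matrix (Fin b) (Fin c) ℝ) :
    k * frob X ^ 2 ≤ frob (A * X) ^ 2 := by
  rw [frob_mul_sq_eq_sum_col, frob_sq_eq_sum_col, Finset.mul_sum]
  exact Finset.sum_le_sum fun j _ => h _

/-- A matrix and its transpose have the same operator norm. -/
lemma frob_transpose_mul_sq_le {A : Matrix (Fin a) (Fin b) ℝ} {k : ℝ} (hk : 0 ≤ k)
    (h : ∀ x, (A *ᵥ x) ⬝ᵥ (A *ᵥ x) ≤ k * (x ⬝ᵥ x)) (X : Matrix (Fin a) (Fin c) ℝ) :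
    frob (Aᵀ * X) ^ 2 ≤ k * frob X ^ 2 := by
  have h1 : frob (Aᵀ * X) ^ 2 ≤ frob X * frob (A * (Aᵀ * X)) := by
    rw [← trace_transpose_mul_self, transpose_mul, transpose_transpose, Matrix.mul_assoc]
    exact trace_transpose_mul_le _ _
  have h2 := frob_mul_sq_le h (Aᵀ * X)
  have h0 := frob_nonneg (Aᵀ * X)
  have h3 : (frob (Aᵀ * X) ^ 2) ^ 2 ≤ frob X ^ 2 * (k * frob (Aᵀ * X) ^ 2) := by
    calc (frob (Aᵀ * X) ^ 2) ^ 2 ≤ (frob X * frob (A * (Aᵀ * X))) ^ 2 := by gcongr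
      _ = frob X ^ 2 * frob (A * (Aᵀ * X)) ^ 2 := by ring
      _ ≤ _ := by gcongr
  rcases h0.eq_or_lt with h4 | h4
  · rw [← h4]
    simpa using mul_nonneg hk (sq_nonneg (frob X))
  · have h5 : 0 < frob (Aᵀ * X) ^ 2 := by positivity
    nlinarith

/-! ### Extreme eigenvalues -/

lemma dotProduct_mulVec_eigen_sum {A : Matrix (Fin a) (Fin a) ℝ} (hA : A.IsHermitian)
    (x : Fin a → ℝ) : ∃ y : Fin a → ℝ,
      x ⬝ᵥ (A *ᵥ x) = ∑ i, hA.eigenvalues i * y i ^ 2 ∧ x ⬝ᵥ x = ∑ i, y i ^ 2 := by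
  set U : Matrix (Fin a) (Fin a) ℝ := hA.eigenvectorUnitary.1 with hU
  have hUU : U * Uᵀ = 1 := by
    have := (Matrix.mem_unitaryGroup_iff).1 hA.eigenvectorUnitary.2
    simpa [star_eq_conjTranspose] using this
  have hs : A = U * diagonal hA.eigenvalues * Uᵀ := by
    have := hA.spectral_theorem
    simpa [Unitary.conjStarAlgAut_apply, star_eq_conjTranspose, Function.comp_def] using this
  refine ⟨Uᵀ *ᵥ x, ?_, ?_⟩
  · conv_lhs => rw [hs]
    rw [← mulVec_mulVec, ← mulVec_mulVec, dotProduct_mulVec, ← mulVec_transpose]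
    simp [dotProduct, mulVec_diagonal]
    exact Finset.sum_congr rfl fun i _ => by ring
  · have : x ⬝ᵥ x = (Uᵀ *ᵥ x) ⬝ᵥ (Uᵀ *ᵥ x) := by
      rw [dotProduct_mulVec, ← mulVec_transpose, mulVec_mulVec, transpose_transpose, hUU,
        one_mulVec]
    rw [this]
    simp [dotProduct, sq]

lemma dotProduct_mulVec_le_lamMax {A : Matrix (Fin a) (Fin a) ℝ} (hA : A.IsHermitian)
    (x : Fin a → ℝ) : x ⬝ᵥ (A *ᵥ x) ≤ lamMax A * (x ⬝ᵥ x) := by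
  obtain ⟨y, h1, h2⟩ := dotProduct_mulVec_eigen_sum hA x
  rw [h1, h2, Finset.mul_sum]
  refine Finset.sum_le_sum fun i _ => mul_le_mul_of_nonneg_right ?_ (sq_nonneg _)
  exact le_csSup A.finite_real_spectrum.bddAbove (hA.eigenvalues_mem_spectrum_real i)

lemma lamMin_mul_le_dotProduct_mulVec {A : Matrix (Fin a) (Fin a) ℝ} (hA : A.IsHermitian)
    (x : Fin a → ℝ) : lamMin A * (x ⬝ᵥ x) ≤ x ⬝ᵥ (A *ᵥ x) := by
  obtain ⟨y, h1, h2⟩ := dotProduct_mulVec_eigen_sum hA x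
  rw [h1, h2, Finset.mul_sum]
  refine Finset.sum_le_sum fun i _ => mul_le_mul_of_nonneg_right ?_ (sq_nonneg _)
  exact csInf_le A.finite_real_spectrum.bddBelow (hA.eigenvalues_mem_spectrum_real i)

lemma lamMin_pos (ha : 0 < a) {A : Matrix (Fin a) (Fin a) ℝ} (hA : A.PosDef) : 0 < lamMin A := by
  have : Nonempty (Fin a) := ⟨⟨0, ha⟩⟩
  have hne : (spectrum ℝ A).Nonempty := by
    rw [hA.1.spectrum_real_eq_range_eigenvalues]
    exact Set.range_nonempty _
  have hmem := hne.csInf_mem A.finite_real_spectrum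
  rw [hA.1.spectrum_real_eq_range_eigenvalues] at hmem
  obtain ⟨i, hi⟩ := hmem
  rw [lamMin, hA.1.spectrum_real_eq_range_eigenvalues, ← hi]
  exact hA.eigenvalues_pos i

lemma lamMin_le_lamMax (ha : 0 < a) {A : Matrix (Fin a) (Fin a) ℝ} (hA : A.IsHermitian) :
    lamMin A ≤ lamMax A := by
  have h1 := lamMin_mul_le_dotProduct_mulVec hA (Pi.single ⟨0, ha⟩ 1)
  have h2 := dotProduct_mulVec_le_lamMax hA (Pi.single ⟨0, ha⟩ 1)
  have h3 : (Pi.single ⟨0, ha⟩ 1 : Fin a → ℝ) ⬝ᵥ Pi.single ⟨0, ha⟩ 1 = 1 := by simp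
  rw [h3] at h1 h2
  linarith

/-- Two positive definite quadratic forms are diagonalised by one congruence. -/
lemma exists_congr_one_diagonal {Λ₀ Λ : Matrix (Fin a) (Fin a) ℝ} (h₀ : Λ₀.PosDef)
    (h : Λ.PosDef) : ∃ (P : Matrix (Fin a) (Fin a) ℝ) (d : Fin a → ℝ), (∀ i, 0 < d i) ∧
      Pᵀ * Λ₀ * P = 1 ∧ Pᵀ * Λ * P = diagonal d := by
  obtain ⟨B, hB⟩ : ∃ B : Matrix (Fin a) (Fin a) ℝ, Λ₀ = Bᵀ * B := by
    obtain ⟨B, hB⟩ := (by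
      open scoped MatrixOrder in
      exact CStarAlgebra.nonneg_iff_eq_star_mul_self.mp h₀.posSemidef.nonneg :
        ∃ B : Matrix (Fin a) (Fin a) ℝ, Λ₀ = star B * B)
    exact ⟨B, by simpa [star_eq_conjTranspose] using hB⟩
  have hdet : IsUnit B.det := by
    have := h₀.det_pos
    rw [hB, det_mul, det_transpose] at this
    exact isUnit_iff_ne_zero.2 fun h => by simp [h] at this
  have hBu : IsUnit B⁻¹ := by
    rw [isUnit_iff_isUnit_det]
    exact isUnit_nonsing_inv_det B hdet
  set A := (B⁻¹)ᵀ * Λ * B⁻¹ with hAdef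
  have hA : A.PosDef := by
    have := (Matrix.IsUnit.posDef_star_left_conjugate_iff (x := Λ) hBu).2 h
    simpa [star_eq_conjTranspose] using this
  set U : Matrix (Fin a) (Fin a) ℝ := hA.1.eigenvectorUnitary.1 with hU
  have hUU : Uᵀ * U = 1 := by
    have := (Matrix.mem_unitaryGroup_iff').1 hA.1.eigenvectorUnitary.2
    simpa [star_eq_conjTranspose] using this
  have hs : A = U * diagonal hA.1.eigenvalues * Uᵀ := by
    have := hA.1.spectral_theorem
    simpa [Unitary.conjStarAlgAut_apply, star_eq_conjTranspose, Function.comp_def] using this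
  refine ⟨B⁻¹ * U, hA.1.eigenvalues, hA.eigenvalues_pos, ?_, ?_⟩
  · have hBB : B * B⁻¹ = 1 := mul_nonsing_inv _ hdet
    calc (B⁻¹ * U)ᵀ * Λ₀ * (B⁻¹ * U) = Uᵀ * ((B * B⁻¹)ᵀ * (B * B⁻¹)) * U := by
          rw [hB]; simp only [transpose_mul, Matrix.mul_assoc]
      _ = 1 := by simp [hBB, hUU]
  · calc (B⁻¹ * U)ᵀ * Λ * (B⁻¹ * U) = Uᵀ * A * U := by
          rw [hAdef]; simp only [transpose_mul, Matrix.mul_assoc]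
      _ = (Uᵀ * U) * diagonal hA.1.eigenvalues * (Uᵀ * U) := by
          conv_lhs => rw [hs]
          simp only [Matrix.mul_assoc]
      _ = _ := by simp [hUU]

/-- The quadratic growth of `x - 1 - log x` at `x = 1`, on `(0, V]`. -/
lemma sq_div_le_sub_one_sub_log {x V : ℝ} (hx : 0 < x) (hV : 1 ≤ V) (hxV : x ≤ V) :
    (x - 1) ^ 2 / (2 * V) ≤ x - 1 - Real.log x := by
  rcases le_total 1 x with h | h
  · have h1 : Real.log x ≤ (x - x⁻¹) / 2 := by
      have := Real.self_le_sinh_iff.2 (Real.log_nonneg h)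
      rwa [Real.sinh_log hx] at this
    have h2 : (x - 1) ^ 2 / (2 * V) ≤ (x - 1) ^ 2 / (2 * x) := by gcongr
    have h3 : (x - 1) ^ 2 / (2 * x) = x - 1 - (x - x⁻¹) / 2 := by field_simp; ring
    linarith
  · have h0 : |1 - x| < 1 := by rw [abs_lt]; constructor <;> linarith
    have h1 := Real.hasSum_pow_div_log_of_abs_lt_one h0
    have h2 := sum_le_hasSum (Finset.range 2)
      (fun n _ => div_nonneg (pow_nonneg (by linarith : 0 ≤ 1 - x) _) (by positivity)) h1
    simp [Finset.sum_range_succ] at h2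
    have h3 : (x - 1) ^ 2 / (2 * V) ≤ (x - 1) ^ 2 / (2 * 1) := by gcongr
    nlinarith

/-! ### Curvature of the likelihood -/

/-- The Bregman divergence of `-(2 / n) l` between `(Θ, Λ)` and `(Θ₀, Λ₀)`, in closed form, when
the second moment matrix of the design is `S`: up to a factor, the average Kullback-Leibler
divergence between the two Gaussian conditional models. -/
noncomputable def likDiv (S : Matrix (Fin q) (Fin q) ℝ) (Θ₀ Θ : Matrix (Fin q) (Fin p) ℝ)
    (Λ₀ Λ : Matrix (Fin p) (Fin p) ℝ) : ℝ :=
  Real.log Λ₀.det - Real.log Λ.det + (Λ₀⁻¹ * (Λ - Λ₀)).trace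
    + (Λ⁻¹ * ((Θ - Θ₀ * Λ₀⁻¹ * Λ)ᵀ * S * (Θ - Θ₀ * Λ₀⁻¹ * Λ))).trace

lemma dotProduct_transpose_mul_self_mulVec (A : Matrix (Fin n) (Fin q) ℝ) (x : Fin q → ℝ) :
    x ⬝ᵥ ((Aᵀ * A) *ᵥ x) = (A *ᵥ x) ⬝ᵥ (A *ᵥ x) := by
  rw [← mulVec_mulVec, dotProduct_mulVec x, vecMul_transpose]

lemma frob_diagonal_sq (d : Fin p → ℝ) : frob (diagonal d) ^ 2 = ∑ i, d i ^ 2 := by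
  rw [frob_sq]
  refine Finset.sum_congr rfl fun i _ => ?_
  rw [Finset.sum_eq_single i]
  · simp
  · intro j _ hj
    simp [diagonal_apply_ne' _ hj]
  · simp

lemma trace_diagonal_mul_transpose_mul_self (d : Fin p → ℝ) (Z : Matrix (Fin n) (Fin p) ℝ) :
    (diagonal d * (Zᵀ * Z)).trace = ∑ i, d i * ∑ k, Z k i ^ 2 := by
  refine Finset.sum_congr rfl fun i _ => ?_
  rw [diag_apply, diagonal_mul, Matrix.mul_apply]
  simp [sq]

/-- Quadratic growth of the divergence. The loss of curvature far from `Λ₀` is the single factor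
`V = 1 + ‖Λ₀⁻¹‖_F ‖Λ - Λ₀‖_F`, so that no localisation is needed. The number `μ` is the Frobenius
norm of `Λ - Λ₀` in coordinates where `Λ₀` is the identity. -/
lemma exists_le_likDiv {Λ₀ Λ : Matrix (Fin p) (Fin p) ℝ} (h₀ : Λ₀.PosDef) (h : Λ.PosDef)
    (A : Matrix (Fin n) (Fin q) ℝ) (Θ₀ Θ : Matrix (Fin q) (Fin p) ℝ) {m M τ : ℝ} (hm : 0 < m)
    (hM : 0 < M) (hτ : 0 ≤ τ)
    (hlow : ∀ x, m * (x ⬝ᵥ x) ≤ x ⬝ᵥ (Λ₀ *ᵥ x)) (hupp : ∀ x, x ⬝ᵥ (Λ₀ *ᵥ x) ≤ M * (x ⬝ᵥ x))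
    (hΘ₀ : ∀ x, ((A * Θ₀) *ᵥ x) ⬝ᵥ ((A * Θ₀) *ᵥ x) ≤ τ * (x ⬝ᵥ x)) :
    ∃ μ : ℝ, frob (Λ - Λ₀) ^ 2 ≤ M ^ 2 * μ ^ 2 ∧ ∀ w : ℝ, 0 ≤ w → w ≤ 1 →
      μ ^ 2 / 2 + w * (frob (A * (Θ - Θ₀)) ^ 2 / (2 * M) - τ / m * μ ^ 2) ≤
        (1 + frob Λ₀⁻¹ * frob (Λ - Λ₀)) * likDiv (Aᵀ * A) Θ₀ Θ Λ₀ Λ := by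
  obtain ⟨P, d, hd, hP₀, hP⟩ := exists_congr_one_diagonal h₀ h
  set Q := Pᵀ * Λ₀ with hQ
  have hQP : Q * P = 1 := hP₀
  have hPQ : P * Q = 1 := mul_eq_one_comm.1 hQP
  have hΛ₀u : IsUnit Λ₀.det := isUnit_iff_ne_zero.2 h₀.det_pos.ne'
  have hinv : Λ₀⁻¹ = P * Pᵀ := by
    refine inv_eq_left_inv ?_
    rw [Matrix.mul_assoc, ← hQ, hPQ]
  have hQQ : Λ₀ = Qᵀ * Q := by
    have hsym : Λ₀ᵀ = Λ₀ := h₀.1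
    calc Λ₀ = Λ₀ * (P * Q) := by rw [hPQ, Matrix.mul_one]
      _ = Qᵀ * Q := by rw [hQ]; simp [hsym, Matrix.mul_assoc]
  have hPt : Qᵀ * Pᵀ = 1 := by rw [← transpose_mul, hPQ, transpose_one]
  have hPt' : Pᵀ * Qᵀ = 1 := by rw [← transpose_mul, hQP, transpose_one]
  have hΛ : Λ = Qᵀ * diagonal d * Q := by
    calc Λ = (Qᵀ * Pᵀ) * Λ * (P * Q) := by rw [hPt, hPQ, Matrix.one_mul, Matrix.mul_one]
      _ = Qᵀ * (Pᵀ * Λ * P) * Q := by simp only [Matrix.mul_assoc]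
      _ = _ := by rw [hP]
  have hΛinv : Λ⁻¹ = P * diagonal (fun i => (d i)⁻¹) * Pᵀ := by
    refine inv_eq_left_inv ?_
    have hdd : diagonal (fun i => (d i)⁻¹) * diagonal d = 1 := by
      rw [diagonal_mul_diagonal, ← diagonal_one]
      congr 1; ext i; exact inv_mul_cancel₀ (hd i).ne'
    calc P * diagonal (fun i => (d i)⁻¹) * Pᵀ * Λ
        = P * (diagonal (fun i => (d i)⁻¹) * ((Pᵀ * Qᵀ) * diagonal d)) * Q := by
          conv_lhs => rw [hΛ]
          simp only [Matrix.mul_assoc]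
      _ = 1 := by rw [hPt', Matrix.one_mul, hdd, Matrix.mul_one, hPQ]
  -- `N` is `Λ - Λ₀` in the coordinates where `Λ₀` is the identity
  set N : Matrix (Fin p) (Fin p) ℝ := diagonal (fun i => d i - 1) with hN
  have hNP : Pᵀ * (Λ - Λ₀) * P = N := by
    rw [Matrix.mul_sub, Matrix.sub_mul, hP, ← hQ, hQP, hN, ← diagonal_one, diagonal_sub]
  have hNQ : Λ - Λ₀ = Qᵀ * N * Q := by
    calc Λ - Λ₀ = (Qᵀ * Pᵀ) * (Λ - Λ₀) * (P * Q) := by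
          rw [hPt, hPQ, Matrix.one_mul, Matrix.mul_one]
      _ = Qᵀ * (Pᵀ * (Λ - Λ₀) * P) * Q := by simp only [Matrix.mul_assoc]
      _ = _ := by rw [hNP]
  have hquad : ∀ x, (Q *ᵥ x) ⬝ᵥ (Q *ᵥ x) = x ⬝ᵥ (Λ₀ *ᵥ x) := by
    intro x
    conv_rhs => rw [hQQ, dotProduct_transpose_mul_self_mulVec]
  have hQle : ∀ x, (Q *ᵥ x) ⬝ᵥ (Q *ᵥ x) ≤ M * (x ⬝ᵥ x) := fun x => (hquad x).trans_le (hupp x)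
  have hQge : ∀ x, m * (x ⬝ᵥ x) ≤ (Q *ᵥ x) ⬝ᵥ (Q *ᵥ x) := fun x => (hlow x).trans_eq (hquad x).symm
  have hQright : ∀ {k : ℕ} (Z : Matrix (Fin k) (Fin p) ℝ), frob (Z * Q) ^ 2 ≤ M * frob Z ^ 2 := by
    intro k Z
    have := frob_transpose_mul_sq_le hM.le hQle Zᵀ
    rwa [← transpose_mul, frob_transpose, frob_transpose] at this
  set V := 1 + frob Λ₀⁻¹ * frob (Λ - Λ₀) with hV
  have hV1 : 1 ≤ V := by
    have := mul_nonneg (frob_nonneg Λ₀⁻¹) (frob_nonneg (Λ - Λ₀))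
    linarith
  have hNsym : Nᵀ = N := by rw [hN, diagonal_transpose]
  have hNV : frob N ≤ V - 1 := by
    have h1 : frob N ^ 2 ≤ (frob (Λ₀⁻¹ * (Λ - Λ₀))) ^ 2 := by
      have h2 : frob N ^ 2 = ((Λ₀⁻¹ * (Λ - Λ₀)) * (Λ₀⁻¹ * (Λ - Λ₀))).trace := by
        rw [← trace_transpose_mul_self, hNsym, ← hNP, hinv]
        rw [show P * Pᵀ * (Λ - Λ₀) * (P * Pᵀ * (Λ - Λ₀))
          = P * (Pᵀ * (Λ - Λ₀) * P * (Pᵀ * (Λ - Λ₀))) by simp only [Matrix.mul_assoc],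
          trace_mul_comm P]
        simp only [Matrix.mul_assoc]
      rw [h2]
      have h3 := trace_transpose_mul_le (Λ₀⁻¹ * (Λ - Λ₀))ᵀ (Λ₀⁻¹ * (Λ - Λ₀))
      rw [transpose_transpose, frob_transpose] at h3
      linarith [sq (frob (Λ₀⁻¹ * (Λ - Λ₀)))]
    have h2 := (abs_le_of_sq_le_sq' h1 (frob_nonneg _)).2
    have := frob_mul_le Λ₀⁻¹ (Λ - Λ₀)
    linarith
  have hdV : ∀ i, d i ≤ V := by
    intro i
    have := abs_apply_le_frob N i i
    rw [hN, diagonal_apply_eq, ← hN] at this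
    have := le_abs_self (d i - 1)
    linarith
  have hdet : Real.log Λ₀.det - Real.log Λ.det = -∑ i, Real.log (d i) := by
    have h1 : Pᵀ.det * Λ₀.det * P.det = 1 := by rw [← det_mul, ← det_mul, ← hQ, hQP, det_one]
    have h2 : Pᵀ.det * Λ.det * P.det = ∏ i, d i := by
      rw [← det_mul, ← det_mul, hP, det_diagonal]
    have h3 : Λ.det = Λ₀.det * ∏ i, d i := by
      rw [← h2]; linear_combination (-Λ.det) * h1
    rw [h3, Real.log_mul h₀.det_pos.ne' (Finset.prod_pos fun i _ => hd i).ne',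
      Real.log_prod fun i _ => (hd i).ne']
    ring
  have htr : (Λ₀⁻¹ * (Λ - Λ₀)).trace = ∑ i, (d i - 1) := by
    rw [hinv, Matrix.mul_assoc, trace_mul_comm, hNP, hN, trace_diagonal]
  set E := Θ - Θ₀ * Λ₀⁻¹ * Λ with hE
  have hquadE : frob (A * E * P) ^ 2 / V ≤ (Λ⁻¹ * (Eᵀ * (Aᵀ * A) * E)).trace := by
    have h1 : (Λ⁻¹ * (Eᵀ * (Aᵀ * A) * E)).trace
        = ∑ i, (d i)⁻¹ * ∑ k, (A * E * P) k i ^ 2 := by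
      rw [← trace_diagonal_mul_transpose_mul_self, hΛinv,
        show P * diagonal (fun i => (d i)⁻¹) * Pᵀ * (Eᵀ * (Aᵀ * A) * E)
          = P * (diagonal (fun i => (d i)⁻¹) * Pᵀ * (Eᵀ * (Aᵀ * A) * E)) by
          simp only [Matrix.mul_assoc], trace_mul_comm P]
      simp only [transpose_mul, Matrix.mul_assoc]
    rw [h1, frob_sq, Finset.sum_comm, Finset.sum_div]
    refine Finset.sum_le_sum fun i _ => ?_
    rw [div_eq_inv_mul]
    exact mul_le_mul_of_nonneg_right (inv_anti₀ (hd i) (hdV i))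
      (Finset.sum_nonneg fun _ _ => sq_nonneg _)
  have hlogs : frob N ^ 2 / (2 * V) ≤ ∑ i, (d i - 1) - ∑ i, Real.log (d i) := by
    rw [hN, frob_diagonal_sq, ← Finset.sum_sub_distrib, Finset.sum_div]
    exact Finset.sum_le_sum fun i _ => sq_div_le_sub_one_sub_log (hd i) hV1 (hdV i)
  have hdiv : frob N ^ 2 / 2 + frob (A * E * P) ^ 2 ≤ V * likDiv (Aᵀ * A) Θ₀ Θ Λ₀ Λ := by
    have hV0 : 0 < V := by linarith
    have h1 : frob N ^ 2 / (2 * V) + frob (A * E * P) ^ 2 / V ≤ likDiv (Aᵀ * A) Θ₀ Θ Λ₀ Λ := by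
      rw [likDiv, hdet, htr]
      linarith
    calc frob N ^ 2 / 2 + frob (A * E * P) ^ 2
        = V * (frob N ^ 2 / (2 * V) + frob (A * E * P) ^ 2 / V) := by field_simp
      _ ≤ _ := by gcongr
  have hEP : A * E * P = A * (Θ - Θ₀) * P + -(A * Θ₀ * (P * N)) := by
    have h1 : E = (Θ - Θ₀) - Θ₀ * (Λ₀⁻¹ * (Λ - Λ₀)) := by
      rw [hE, Matrix.mul_sub, nonsing_inv_mul _ hΛ₀u, Matrix.mul_sub, Matrix.mul_one,
        Matrix.mul_assoc]
      abel
    rw [h1, ← hNP, hinv]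
    simp only [Matrix.mul_sub, Matrix.sub_mul, Matrix.mul_assoc]
    abel
  have hsplit : frob (A * (Θ - Θ₀) * P) ^ 2 / 2 - frob (A * Θ₀ * (P * N)) ^ 2
      ≤ frob (A * E * P) ^ 2 := by
    have h1 := frob_add_le (A * E * P) (A * Θ₀ * (P * N))
    rw [show A * E * P + A * Θ₀ * (P * N) = A * (Θ - Θ₀) * P by rw [hEP]; abel] at h1
    have h2 : frob (A * (Θ - Θ₀) * P) ^ 2 ≤
        (frob (A * E * P) + frob (A * Θ₀ * (P * N))) ^ 2 := by
      have := frob_nonneg (A * (Θ - Θ₀) * P)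
      gcongr
    nlinarith [sq_nonneg (frob (A * E * P) - frob (A * Θ₀ * (P * N)))]
  have hb : frob (A * Θ₀ * (P * N)) ^ 2 ≤ τ / m * frob N ^ 2 := by
    have h1 := frob_mul_sq_le hΘ₀ (P * N)
    have h2 := le_frob_mul_sq hQge (P * N)
    rw [← Matrix.mul_assoc, hQP, Matrix.one_mul] at h2
    have h3 : frob (P * N) ^ 2 ≤ frob N ^ 2 / m := by rw [le_div_iff₀ hm]; linarith
    calc _ ≤ τ * frob (P * N) ^ 2 := h1
      _ ≤ τ * (frob N ^ 2 / m) := by gcongr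
      _ = _ := by ring
  have ha : frob (A * (Θ - Θ₀)) ^ 2 / M ≤ frob (A * (Θ - Θ₀) * P) ^ 2 := by
    have h1 := hQright (A * (Θ - Θ₀) * P)
    rw [Matrix.mul_assoc _ P, hPQ, Matrix.mul_one] at h1
    rw [div_le_iff₀ hM]
    linarith
  refine ⟨frob N, ?_, ?_⟩
  · have h1 := hQright (Qᵀ * N)
    have h2 := frob_transpose_mul_sq_le hM.le hQle N
    rw [← hNQ] at h1
    calc _ ≤ M * frob (Qᵀ * N) ^ 2 := h1
      _ ≤ M * (M * frob N ^ 2) := by gcongr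
      _ = _ := by ring
  · intro w hw hw1
    have h1 : frob (A * (Θ - Θ₀)) ^ 2 / (2 * M) - τ / m * frob N ^ 2
        ≤ frob (A * E * P) ^ 2 := by
      have : frob (A * (Θ - Θ₀)) ^ 2 / (2 * M) = frob (A * (Θ - Θ₀)) ^ 2 / M / 2 := by
        field_simp
      linarith
    have h2 := mul_le_mul_of_nonneg_left h1 hw
    have h3 := mul_le_of_le_one_left (sq_nonneg (frob (A * E * P))) hw1
    linarith

/-! ### The gradient and the Bregman divergence of the log-likelihood -/

lemma empMoment_self_transpose (x : Fin n → Fin q → ℝ) : (empMoment x x)ᵀ = empMoment x x := by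
  simp [empMoment, Matrix.transpose_sum, transpose_vecMulVec]

lemma hasDerivAt_logLik_theta (x : Fin n → Fin q → ℝ) (y : Fin n → Fin p → ℝ)
    (Θ E : Matrix (Fin q) (Fin p) ℝ) {Λ : Matrix (Fin p) (Fin p) ℝ} (hΛ : Λᵀ = Λ) :
    HasDerivAt (fun t : ℝ => logLik x y (Θ + t • E) Λ)
      (-(n : ℝ) * (((empMoment x y)ᵀ + Λ⁻¹ * Θᵀ * empMoment x x) * E).trace) 0 := by
  set S := empMoment x x with hS
  set T := empMoment x y
  have hsym : (Λ⁻¹ * Eᵀ * S * Θ).trace = (Λ⁻¹ * Θᵀ * S * E).trace := by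
    rw [← trace_transpose (Λ⁻¹ * Eᵀ * S * Θ)]
    simp only [transpose_mul, transpose_transpose, transpose_nonsing_inv, hΛ,
      show Sᵀ = S from empMoment_self_transpose x]
    rw [← Matrix.mul_assoc, ← Matrix.mul_assoc, trace_mul_comm]
    simp only [Matrix.mul_assoc]
  have hfun : (fun t : ℝ => logLik x y (Θ + t • E) Λ) = fun t : ℝ => logLik x y Θ Λ
      - (n : ℝ) * (t * ((Tᵀ + Λ⁻¹ * Θᵀ * S) * E).trace
        + t ^ 2 * ((Λ⁻¹ * Eᵀ * S * E).trace / 2)) := by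
    funext t
    simp only [logLik, ← hS]
    simp only [Matrix.mul_add, Matrix.add_mul, transpose_add, transpose_smul, trace_add,
      Matrix.mul_smul, Matrix.smul_mul, trace_smul, smul_eq_mul, smul_add]
    rw [hsym]
    ring
  rw [hfun]
  have h1 := ((hasDerivAt_id (0 : ℝ)).mul_const ((Tᵀ + Λ⁻¹ * Θᵀ * S) * E).trace).add
    (((hasDerivAt_id (0 : ℝ)).pow 2).mul_const ((Λ⁻¹ * Eᵀ * S * E).trace / 2))
  refine ((h1.const_mul (n : ℝ)).const_sub (logLik x y Θ Λ)).congr_deriv ?_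
  simp

lemma hasDerivAt_log_det {Λ : Matrix (Fin p) (Fin p) ℝ} (hΛ : Λ.det ≠ 0)
    (E : Matrix (Fin p) (Fin p) ℝ) :
    HasDerivAt (fun t : ℝ => Real.log (Λ + t • E).det) (Λ⁻¹ * E).trace 0 := by
  set M := Λ⁻¹ * E with hM
  set f := (det (1 + (Polynomial.X : Polynomial ℝ) • M.map Polynomial.C)).divX.divX
  have hdet : ∀ t : ℝ, (Λ + t • E).det = Λ.det * (1 + M.trace * t + f.eval t * t ^ 2) := by
    intro t
    have h1 : Λ + t • E = Λ * (1 + t • M) := by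
      rw [Matrix.mul_add, Matrix.mul_one, Matrix.mul_smul, hM, ← Matrix.mul_assoc,
        mul_nonsing_inv _ (isUnit_iff_ne_zero.2 hΛ), Matrix.one_mul]
    rw [h1, det_mul, Matrix.det_one_add_smul]
  simp only [hdet]
  have h1 := ((((hasDerivAt_id (0 : ℝ)).const_mul M.trace).const_add 1).add
    ((f.hasDerivAt 0).mul ((hasDerivAt_id (0 : ℝ)).pow 2))).const_mul Λ.det
  have h2 := h1.log (by simpa using hΛ)
  refine h2.congr_deriv ?_
  simp [hΛ]

attribute [local instance] Matrix.frobeniusNormedRing Matrix.frobeniusNormedAlgebra in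
lemma hasDerivAt_trace_inv_mul {Λ : Matrix (Fin p) (Fin p) ℝ} (hΛ : Λ.det ≠ 0)
    (E G : Matrix (Fin p) (Fin p) ℝ) :
    HasDerivAt (fun t : ℝ => ((Λ + t • E)⁻¹ * G).trace) (-(Λ⁻¹ * E * Λ⁻¹ * G).trace) 0 := by
  have : CompleteSpace (Matrix (Fin p) (Fin p) ℝ) := FiniteDimensional.complete ℝ _
  obtain ⟨u, rfl⟩ : IsUnit Λ := (isUnit_iff_isUnit_det _).2 (isUnit_iff_ne_zero.2 hΛ)
  have h1 : HasDerivAt (fun t : ℝ => (u : Matrix (Fin p) (Fin p) ℝ) + t • E) E 0 :=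
    (((hasDerivAt_id (0 : ℝ)).smul_const E).const_add
      (u : Matrix (Fin p) (Fin p) ℝ)).congr_deriv (one_smul _ _)
  have h2 := hasFDerivAt_ringInverse (𝕜 := ℝ) u
  have h3 := HasFDerivAt.comp_hasDerivAt_of_eq (0 : ℝ) h2 h1 (by simp)
  let tr : Matrix (Fin p) (Fin p) ℝ →L[ℝ] ℝ :=
    LinearMap.toContinuousLinearMap
      ((Matrix.traceLinearMap (Fin p) ℝ ℝ).comp (LinearMap.mulRight ℝ G))
  have h4 := tr.hasFDerivAt.comp_hasDerivAt (0 : ℝ) h3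
  have hfun : (fun t : ℝ => (((u : Matrix (Fin p) (Fin p) ℝ) + t • E)⁻¹ * G).trace)
      = tr ∘ Ring.inverse ∘ fun t : ℝ => (u : Matrix (Fin p) (Fin p) ℝ) + t • E := by
    funext t
    simp only [Function.comp_apply, nonsing_inv_eq_ringInverse]
    rfl
  rw [hfun]
  refine h4.congr_deriv ?_
  have key : tr ((-ContinuousLinearMap.mulLeftRight ℝ (Matrix (Fin p) (Fin p) ℝ) ↑u⁻¹ ↑u⁻¹) E)
      = (-(((u⁻¹ : (Matrix (Fin p) (Fin p) ℝ)ˣ) : Matrix (Fin p) (Fin p) ℝ) * E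
        * ((u⁻¹ : (Matrix (Fin p) (Fin p) ℝ)ˣ) : Matrix (Fin p) (Fin p) ℝ)) * G).trace := rfl
  refine key.trans ?_
  rw [Matrix.neg_mul, trace_neg, coe_units_inv]

lemma hasDerivAt_logLik_lambda (x : Fin n → Fin q → ℝ) (y : Fin n → Fin p → ℝ)
    (Θ : Matrix (Fin q) (Fin p) ℝ) {Λ : Matrix (Fin p) (Fin p) ℝ} (hΛ : Λ.det ≠ 0)
    (E : Matrix (Fin p) (Fin p) ℝ) :
    HasDerivAt (fun t : ℝ => logLik x y Θ (Λ + t • E))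
      ((n : ℝ) / 2 * ((Λ⁻¹ - empMoment y y + Λ⁻¹ * (Θᵀ * empMoment x x * Θ) * Λ⁻¹) * E).trace)
      0 := by
  have h1 := hasDerivAt_log_det hΛ E
  have h2 := hasDerivAt_trace_inv_mul hΛ E (Θᵀ * empMoment x x * Θ)
  have h3 := (((hasDerivAt_id (0 : ℝ)).mul_const (empMoment y y * E).trace).const_add
    (empMoment y y * Λ + (2 : ℝ) • ((empMoment x y)ᵀ * Θ)).trace).add h2
  have h4 := (h1.sub h3).const_mul ((n : ℝ) / 2)
  have hfun : (fun t : ℝ => logLik x y Θ (Λ + t • E)) = fun t : ℝ => (n : ℝ) / 2 *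
      (Real.log (Λ + t • E).det -
        ((empMoment y y * Λ + (2 : ℝ) • ((empMoment x y)ᵀ * Θ)).trace
          + t * (empMoment y y * E).trace + ((Λ + t • E)⁻¹ * (Θᵀ * empMoment x x * Θ)).trace)) := by
    funext t
    simp only [logLik, Matrix.mul_add, trace_add, Matrix.mul_smul, trace_smul, smul_eq_mul,
      Matrix.mul_assoc]
    ring
  rw [hfun]
  refine h4.congr_deriv ?_
  have h5 : (Λ⁻¹ * E * Λ⁻¹ * (Θᵀ * empMoment x x * Θ)).trace
      = (Λ⁻¹ * (Θᵀ * empMoment x x * Θ) * Λ⁻¹ * E).trace := by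
    rw [show Λ⁻¹ * E * Λ⁻¹ * (Θᵀ * empMoment x x * Θ)
      = (Λ⁻¹ * E) * (Λ⁻¹ * (Θᵀ * empMoment x x * Θ)) by simp only [Matrix.mul_assoc],
      trace_mul_comm]
    simp only [Matrix.mul_assoc]
  rw [h5, Matrix.add_mul, Matrix.sub_mul, trace_add, trace_sub]
  ring

lemma sum_trace_mul_single_mul (G : Matrix (Fin b) (Fin a) ℝ)
    (D : Matrix (Fin a) (Fin b) ℝ) :
    ∑ i, ∑ j, (G * Matrix.single i j (1 : ℝ)).trace * D i j = (G * D).trace := by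
  have h : ∀ i j, (G * Matrix.single i j (1 : ℝ)).trace = G j i := by
    intro i j
    rw [trace_mul_comm]
    simp [Matrix.trace_single_mul]
  simp only [h]
  rw [Finset.sum_comm]
  simp [Matrix.trace, Matrix.mul_apply]

/-- The remainder of the first-order expansion of the log-likelihood at `(Θ₀, Λ₀)` is
`n / 2` times the divergence. -/
lemma logLik_remainder (x : Fin n → Fin q → ℝ) (y : Fin n → Fin p → ℝ)
    (Θ₀ Θ : Matrix (Fin q) (Fin p) ℝ) {Λ₀ Λ : Matrix (Fin p) (Fin p) ℝ} (h₀ : Λ₀.PosDef)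
    (h : Λ.PosDef) :
    logLik x y Θ₀ Λ₀ - logLik x y Θ Λ
      + ∑ i, ∑ j, gradTheta x y Θ₀ Λ₀ i j * (Θ - Θ₀) i j
      + ∑ i, ∑ j, gradLambda x y Θ₀ Λ₀ i j * (Λ - Λ₀) i j
      = (n : ℝ) / 2 * likDiv (empMoment x x) Θ₀ Θ Λ₀ Λ := by
  have hs₀ : Λ₀ᵀ = Λ₀ := h₀.1
  have hs : Λᵀ = Λ := h.1
  have hu₀ : IsUnit Λ₀.det := isUnit_iff_ne_zero.2 h₀.det_pos.ne'
  have hu : IsUnit Λ.det := isUnit_iff_ne_zero.2 h.det_pos.ne'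
  have hθ : ∀ i j, gradTheta x y Θ₀ Λ₀ i j = _ := fun i j =>
    (hasDerivAt_logLik_theta x y Θ₀ (Matrix.single i j (1 : ℝ)) hs₀).deriv
  have hl : ∀ i j, gradLambda x y Θ₀ Λ₀ i j = _ := fun i j =>
    (hasDerivAt_logLik_lambda x y Θ₀ h₀.det_pos.ne' (Matrix.single i j (1 : ℝ))).deriv
  simp only [hθ, hl, mul_assoc, ← Finset.mul_sum, sum_trace_mul_single_mul]
  set S := empMoment x x with hS
  have hSs : Sᵀ = S := empMoment_self_transpose x
  have e1 : (Λ⁻¹ * (Λ * (Λ₀⁻¹ * (Θ₀ᵀ * (S * Θ))))).trace = (Λ₀⁻¹ * (Θ₀ᵀ * (S * Θ))).trace := by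
    rw [nonsing_inv_mul_cancel_left _ _ hu]
  have e2 : (Λ⁻¹ * (Θᵀ * (S * (Θ₀ * (Λ₀⁻¹ * Λ))))).trace = (Λ₀⁻¹ * (Θ₀ᵀ * (S * Θ))).trace := by
    rw [trace_mul_comm, ← trace_transpose]
    simp only [transpose_mul, transpose_transpose, transpose_nonsing_inv, hs, hs₀, hSs,
      Matrix.mul_assoc]
    rw [nonsing_inv_mul_cancel_left _ _ hu]
  have e3 : (Λ⁻¹ * (Λ * (Λ₀⁻¹ * (Θ₀ᵀ * (S * (Θ₀ * (Λ₀⁻¹ * Λ))))))).trace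
      = (Λ₀⁻¹ * (Θ₀ᵀ * (S * (Θ₀ * (Λ₀⁻¹ * Λ))))).trace := by
    rw [nonsing_inv_mul_cancel_left _ _ hu]
  rw [likDiv]
  simp only [logLik, ← hS, transpose_sub, transpose_mul, transpose_nonsing_inv, hs, hs₀,
    Matrix.mul_sub, Matrix.sub_mul, Matrix.add_mul, trace_add, trace_sub,
    trace_smul, smul_eq_mul, Matrix.mul_assoc, e1, e2, e3, nonsing_inv_mul _ hu₀,
    Matrix.mul_one]
  ring

/-! ### The prior -/

lemma laplace_pos {ν : ℝ} (hν : 0 < ν) (t : ℝ) : 0 < laplace t ν := by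
  unfold laplace
  positivity

lemma laplace_le_mul_exp_abs_sub {ν₀ ν : ℝ} (h₀ : 0 < ν₀) (h : ν₀ ≤ ν) (s t : ℝ) :
    laplace t ν ≤ laplace s ν * Real.exp (|t - s| / ν₀) := by
  have hν : 0 < ν := h₀.trans_le h
  rw [laplace, laplace, mul_assoc, ← Real.exp_add]
  have h1 : |t - s| / ν ≤ |t - s| / ν₀ := by gcongr
  have h2 : (|s| - |t|) / ν ≤ |t - s| / ν := by
    gcongr
    rw [abs_sub_comm]
    exact abs_sub_abs_le_abs_sub s t
  rw [sub_div] at h2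
  gcongr
  linarith

lemma laplace_le_mul_exp_neg_abs {ν ν₁ : ℝ} (hν : 0 < ν) (h : ν ≤ ν₁) (t : ℝ) :
    laplace t ν ≤ laplace 0 ν * Real.exp (-(|t| / ν₁)) := by
  have h1 : |t| / ν₁ ≤ |t| / ν := by gcongr
  rw [laplace, laplace, mul_assoc, ← Real.exp_add]
  simp only [abs_zero, zero_div, neg_zero, zero_add]
  gcongr

section SpikeSlab

variable {ρ η ν₀ ν₁ : ℝ}

lemma spikeSlab_pos (hη : 0 ≤ η) (hη1 : η ≤ 1) (h₀ : 0 < ν₀) (h : ν₀ ≤ ν₁) (t : ℝ) :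
    0 < spikeSlab η ν₀ ν₁ t := by
  have h1 := laplace_pos (h₀.trans_le h) t
  have h2 := laplace_pos h₀ t
  rw [spikeSlab]
  rcases hη.eq_or_lt with h3 | h3
  · rw [← h3]; simpa using h2
  · have := mul_nonneg (sub_nonneg.2 hη1) h2.le
    positivity

lemma spikeSlab_le_of_laplace_le (hη : 0 ≤ η) (hη1 : η ≤ 1) {s t e : ℝ}
    (h₁ : laplace t ν₁ ≤ laplace s ν₁ * e) (h₀ : laplace t ν₀ ≤ laplace s ν₀ * e) :
    spikeSlab η ν₀ ν₁ t ≤ spikeSlab η ν₀ ν₁ s * e := by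
  have h3 := mul_le_mul_of_nonneg_left h₁ hη
  have h4 := mul_le_mul_of_nonneg_left h₀ (sub_nonneg.2 hη1)
  rw [spikeSlab, spikeSlab]
  linarith

/-- The change of the logarithm of the prior when an entry moves from `s` to `t`, bounded above:
a gain of at most `|t - s| / ν₀` on the support, a loss of at least `|t - s| / ν₁` off it. -/
noncomputable def penalty (ν₀ ν₁ : ℝ) (supp : Prop) [Decidable supp] (d : ℝ) : ℝ :=
  if supp then |d| / ν₀ else -(|d| / ν₁)

lemma laplace_le_mul_exp_penalty (h₀ : 0 < ν₀) {ν : ℝ} (hν₀ : ν₀ ≤ ν)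
    (hν₁ : ν ≤ ν₁) (supp : Prop) [Decidable supp] {s t : ℝ} (hs : ¬ supp → s = 0) :
    laplace t ν ≤ laplace s ν * Real.exp (penalty ν₀ ν₁ supp (t - s)) := by
  unfold penalty
  split_ifs with hsupp
  · exact laplace_le_mul_exp_abs_sub h₀ hν₀ s t
  · rw [hs hsupp, sub_zero]
    exact laplace_le_mul_exp_neg_abs (h₀.trans_le hν₀) hν₁ t

lemma spikeSlab_le_mul_exp_penalty (hη : 0 ≤ η) (hη1 : η ≤ 1) (h₀ : 0 < ν₀) (h : ν₀ ≤ ν₁)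
    (supp : Prop) [Decidable supp] {s t : ℝ} (hs : ¬ supp → s = 0) :
    spikeSlab η ν₀ ν₁ t ≤ spikeSlab η ν₀ ν₁ s * Real.exp (penalty ν₀ ν₁ supp (t - s)) :=
  spikeSlab_le_of_laplace_le hη hη1 (laplace_le_mul_exp_penalty h₀ h le_rfl supp hs)
    (laplace_le_mul_exp_penalty h₀ le_rfl h supp hs)

lemma prod_le_prod_mul_exp_sum {ι : Type*} (s : Finset ι) {f g c : ι → ℝ} (hf : ∀ i, 0 ≤ f i)
    (h : ∀ i, f i ≤ g i * Real.exp (c i)) :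
    ∏ i ∈ s, f i ≤ (∏ i ∈ s, g i) * Real.exp (∑ i ∈ s, c i) := by
  rw [Real.exp_sum, ← Finset.prod_mul_distrib]
  exact Finset.prod_le_prod (fun i _ => hf i) fun i _ => h i

open Classical in
lemma log_priorTheta_le (hρ : 0 ≤ ρ) (hρ1 : ρ ≤ 1) (hη : 0 ≤ η) (hη1 : η ≤ 1) (h₀ : 0 < ν₀)
    (h : ν₀ ≤ ν₁) (Θ₀ Θ : Matrix (Fin q) (Fin p) ℝ) :
    Real.log (priorTheta ρ η ν₀ ν₁ Θ) ≤ Real.log (priorTheta ρ η ν₀ ν₁ Θ₀)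
      + ∑ i, ∑ j, penalty ν₀ ν₁ (∃ k, Θ₀ i k ≠ 0) ((Θ - Θ₀) i j) := by
  have hpos : ∀ t : Fin p → ℝ, 0 < ρ * ∏ j, spikeSlab η ν₀ ν₁ (t j)
      + (1 - ρ) * ∏ j, laplace (t j) ν₀ := by
    intro t
    have h1 : 0 < ∏ j, spikeSlab η ν₀ ν₁ (t j) :=
      Finset.prod_pos fun j _ => spikeSlab_pos hη hη1 h₀ h _
    have h2 : 0 < ∏ j, laplace (t j) ν₀ := Finset.prod_pos fun j _ => laplace_pos h₀ _
    rcases hρ.eq_or_lt with h3 | h3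
    · rw [← h3]; simpa using h2
    · have := mul_nonneg (sub_nonneg.2 hρ1) h2.le
      positivity
  have hle : priorTheta ρ η ν₀ ν₁ Θ ≤ priorTheta ρ η ν₀ ν₁ Θ₀
      * Real.exp (∑ i, ∑ j, penalty ν₀ ν₁ (∃ k, Θ₀ i k ≠ 0) ((Θ - Θ₀) i j)) := by
    refine prod_le_prod_mul_exp_sum _ (fun i => (hpos _).le) fun i => ?_
    have hs : ∀ j, ¬ (∃ k, Θ₀ i k ≠ 0) → Θ₀ i j = 0 := by
      intro j hk
      push Not at hk
      exact hk j
    have h1 := prod_le_prod_mul_exp_sum Finset.univ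
      (fun j => (spikeSlab_pos hη hη1 h₀ h (Θ i j)).le)
      (fun j => spikeSlab_le_mul_exp_penalty hη hη1 h₀ h (∃ k, Θ₀ i k ≠ 0) (hs j))
    have h2 := prod_le_prod_mul_exp_sum Finset.univ
      (fun j => (laplace_pos h₀ (Θ i j)).le)
      (fun j => laplace_le_mul_exp_penalty h₀ le_rfl h (∃ k, Θ₀ i k ≠ 0) (hs j))
    have h3 := mul_le_mul_of_nonneg_left h1 hρ
    have h4 := mul_le_mul_of_nonneg_left h2 (sub_nonneg.2 hρ1)
    simp only [Matrix.sub_apply]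
    linarith
  have hP₀ : 0 < priorTheta ρ η ν₀ ν₁ Θ₀ := Finset.prod_pos fun i _ => hpos _
  have hP : 0 < priorTheta ρ η ν₀ ν₁ Θ := Finset.prod_pos fun i _ => hpos _
  have := Real.log_le_log hP hle
  rwa [Real.log_mul hP₀.ne' (Real.exp_pos _).ne', Real.log_exp] at this

/-- The prior of `Λ` runs over pairs `i < j`, the other quantities over all entries. -/
lemma sum_Ioi_le_half_sum {g : Fin p → Fin p → ℝ} (hsymm : ∀ i j, g i j = g j i)
    (hdiag : ∀ i, 0 ≤ g i i) : ∑ i, ∑ j ∈ Finset.Ioi i, g i j ≤ (∑ i, ∑ j, g i j) / 2 := by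
  have h1 : ∀ i, ∑ j, g i j = ∑ j ∈ Finset.Ioi i, g i j + ∑ j ∈ Finset.Iio i, g i j + g i i := by
    intro i
    have : (Finset.univ : Finset (Fin p)) = (Finset.Ioi i ∪ Finset.Iio i) ∪ {i} := by
      ext j
      simp only [Finset.mem_univ, Finset.mem_union, Finset.mem_Ioi, Finset.mem_Iio,
        Finset.mem_singleton, true_iff]
      rcases lt_trichotomy i j with h | h | h
      · exact Or.inl (Or.inl h)
      · exact Or.inr h.symm
      · exact Or.inl (Or.inr h)
    rw [this, Finset.sum_union, Finset.sum_union, Finset.sum_singleton]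
    · rw [Finset.disjoint_left]
      intro j hj hj'
      rw [Finset.mem_Ioi] at hj
      rw [Finset.mem_Iio] at hj'
      exact lt_asymm hj hj'
    · simp
  have h2 : ∑ i, ∑ j ∈ Finset.Iio i, g i j = ∑ i, ∑ j ∈ Finset.Ioi i, g i j := by
    rw [Finset.sum_comm' (t' := Finset.univ) (s' := fun j => Finset.Ioi j)]
    · exact Finset.sum_congr rfl fun i _ => Finset.sum_congr rfl fun j _ => hsymm j i
    · simp
  have h3 : 0 ≤ ∑ i, g i i := Finset.sum_nonneg fun i _ => hdiag i
  simp only [h1, Finset.sum_add_distrib, h2]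
  linarith

open Classical in
lemma log_priorLambda_le (hη : 0 ≤ η) (hη1 : η ≤ 1) (h₀ : 0 < ν₀) (h : ν₀ ≤ ν₁)
    {Λ₀ Λ : Matrix (Fin p) (Fin p) ℝ} (hΛ₀ : Λ₀.PosDef) (hΛ : Λ.PosDef) :
    Real.log (priorLambda η ν₀ ν₁ Λ) ≤ Real.log (priorLambda η ν₀ ν₁ Λ₀)
      + (∑ i, ∑ j, penalty ν₀ ν₁ (Λ₀ i j ≠ 0) ((Λ - Λ₀) i j)) / 2 := by
  have hpos : ∀ A : Matrix (Fin p) (Fin p) ℝ, ∀ i,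
      0 < ∏ j ∈ Finset.Ioi i, spikeSlab η ν₀ ν₁ (A i j) := fun A i =>
    Finset.prod_pos fun j _ => spikeSlab_pos hη hη1 h₀ h _
  have hle : priorLambda η ν₀ ν₁ Λ ≤ priorLambda η ν₀ ν₁ Λ₀
      * Real.exp (∑ i, ∑ j ∈ Finset.Ioi i, penalty ν₀ ν₁ (Λ₀ i j ≠ 0) ((Λ - Λ₀) i j)) := by
    refine prod_le_prod_mul_exp_sum _ (fun i => (hpos Λ i).le) fun i => ?_
    refine prod_le_prod_mul_exp_sum _ (fun j => (spikeSlab_pos hη hη1 h₀ h _).le) fun j => ?_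
    exact spikeSlab_le_mul_exp_penalty hη hη1 h₀ h (Λ₀ i j ≠ 0) fun hn => not_not.1 hn
  have hP₀ : 0 < priorLambda η ν₀ ν₁ Λ₀ := Finset.prod_pos fun i _ => hpos Λ₀ i
  have hP : 0 < priorLambda η ν₀ ν₁ Λ := Finset.prod_pos fun i _ => hpos Λ i
  have h1 := Real.log_le_log hP hle
  rw [Real.log_mul hP₀.ne' (Real.exp_pos _).ne', Real.log_exp] at h1
  have hs₀ : ∀ i j, Λ₀ i j = Λ₀ j i := fun i j => (hΛ₀.1.apply i j).symm
  have hs : ∀ i j, Λ i j = Λ j i := fun i j => (hΛ.1.apply i j).symm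
  have h2 := sum_Ioi_le_half_sum
    (g := fun i j => penalty ν₀ ν₁ (Λ₀ i j ≠ 0) ((Λ - Λ₀) i j))
    (fun i j => by rw [Matrix.sub_apply, Matrix.sub_apply, hs₀ i j, hs i j])
    (fun i => by
      simp only [penalty, hΛ₀.diag_pos.ne', ne_eq, not_false_eq_true, if_true]
      positivity)
  linarith

end SpikeSlab

/-! ### The basic inequality -/

lemma abs_apply_le_maxNorm (A : Matrix (Fin a) (Fin b) ℝ) (i : Fin a) (j : Fin b) :
    |A i j| ≤ maxNorm A :=
  le_ciSup (f := fun ij : Fin a × Fin b => |A ij.1 ij.2|) (Set.finite_range _).bddAbove (i, j)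

open Classical in
/-- The `ℓ¹` norm of `(Θ - Θ₀, Λ - Λ₀)` over the nonzero rows of `Θ₀` and the support of `Λ₀`. -/
noncomputable def onSupport (Θ₀ Θ : Matrix (Fin q) (Fin p) ℝ) (Λ₀ Λ : Matrix (Fin p) (Fin p) ℝ) :
    ℝ :=
  (∑ i, ∑ j, if ∃ k, Θ₀ i k ≠ 0 then |(Θ - Θ₀) i j| else 0)
    + ∑ i, ∑ j, if Λ₀ i j ≠ 0 then |(Λ - Λ₀) i j| else 0

open Classical in
/-- The `ℓ¹` norm of `Θ - Θ₀` over the zero rows of `Θ₀`. -/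
noncomputable def offSupport (Θ₀ Θ : Matrix (Fin q) (Fin p) ℝ) : ℝ :=
  ∑ i, ∑ j, if ∃ k, Θ₀ i k ≠ 0 then 0 else |(Θ - Θ₀) i j|

/-- At a point of higher posterior density than the truth, the prior outweighs the gradient off
the support. The entries of `Λ` off the support only break even, because the prior of `Λ` counts
each off-diagonal pair once; they drop out. -/
lemma likDiv_le_of_negLogPost_le {ρ η ν₀ ν₁ : ℝ} (hρ : 0 ≤ ρ) (hρ1 : ρ ≤ 1) (hη : 0 ≤ η)
    (hη1 : η ≤ 1) (h₀ : 0 < ν₀) (h : ν₀ ≤ ν₁) {x : Fin n → Fin q → ℝ} {y : Fin n → Fin p → ℝ}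
    {Θ₀ Θ : Matrix (Fin q) (Fin p) ℝ} {Λ₀ Λ : Matrix (Fin p) (Fin p) ℝ} (hΛ₀ : Λ₀.PosDef)
    (hΛ : Λ.PosDef) (hgrad : 2 * gradNorm x y Θ₀ Λ₀ < 1 / ν₁)
    (hpost : negLogPost ρ η ν₀ ν₁ x y Θ Λ ≤ negLogPost ρ η ν₀ ν₁ x y Θ₀ Λ₀) :
    (n : ℝ) / 2 * likDiv (empMoment x x) Θ₀ Θ Λ₀ Λ ≤
      (1 / ν₀ + 1 / (2 * ν₁)) * onSupport Θ₀ Θ Λ₀ Λ - 1 / (2 * ν₁) * offSupport Θ₀ Θ := by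
  classical
  have hν₁ : 0 < ν₁ := h₀.trans_le h
  have hinv : 1 / (2 * ν₁) = 1 / ν₁ / 2 := by field_simp
  have hg : gradNorm x y Θ₀ Λ₀ ≤ 1 / (2 * ν₁) := by rw [hinv]; linarith
  have hT : ∀ i j, gradTheta x y Θ₀ Λ₀ i j * (Θ - Θ₀) i j ≤ 1 / (2 * ν₁) * |(Θ - Θ₀) i j| := by
    intro i j
    calc _ ≤ |gradTheta x y Θ₀ Λ₀ i j| * |(Θ - Θ₀) i j| := by rw [← abs_mul]; exact le_abs_self _
      _ ≤ _ := by
        gcongr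
        exact ((abs_apply_le_maxNorm _ i j).trans (le_max_left _ _)).trans hg
  have hL : ∀ i j, gradLambda x y Θ₀ Λ₀ i j * (Λ - Λ₀) i j ≤ 1 / (2 * ν₁) * |(Λ - Λ₀) i j| := by
    intro i j
    calc _ ≤ |gradLambda x y Θ₀ Λ₀ i j| * |(Λ - Λ₀) i j| := by rw [← abs_mul]; exact le_abs_self _
      _ ≤ _ := by
        gcongr
        exact ((abs_apply_le_maxNorm _ i j).trans (le_max_right _ _)).trans hg
  have h1 := log_priorTheta_le hρ hρ1 hη hη1 h₀ h Θ₀ Θ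
  have h2 := log_priorLambda_le hη hη1 h₀ h hΛ₀ hΛ
  have h3 := logLik_remainder x y Θ₀ Θ hΛ₀ hΛ
  have h4 : (n : ℝ) / 2 * likDiv (empMoment x x) Θ₀ Θ Λ₀ Λ ≤
      (∑ i, ∑ j, (gradTheta x y Θ₀ Λ₀ i j * (Θ - Θ₀) i j
        + penalty ν₀ ν₁ (∃ k, Θ₀ i k ≠ 0) ((Θ - Θ₀) i j)))
      + ∑ i, ∑ j, (gradLambda x y Θ₀ Λ₀ i j * (Λ - Λ₀) i j
        + penalty ν₀ ν₁ (Λ₀ i j ≠ 0) ((Λ - Λ₀) i j) / 2) := by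
    simp only [Finset.sum_add_distrib, ← Finset.sum_div]
    rw [negLogPost, negLogPost] at hpost
    linarith
  refine h4.trans ?_
  have h5 : (1 / ν₀ + 1 / (2 * ν₁)) * onSupport Θ₀ Θ Λ₀ Λ - 1 / (2 * ν₁) * offSupport Θ₀ Θ
      = (∑ i, ∑ j, ((1 / ν₀ + 1 / (2 * ν₁)) * (if ∃ k, Θ₀ i k ≠ 0 then |(Θ - Θ₀) i j| else 0)
        - 1 / (2 * ν₁) * (if ∃ k, Θ₀ i k ≠ 0 then 0 else |(Θ - Θ₀) i j|)))
      + ∑ i, ∑ j, (1 / ν₀ + 1 / (2 * ν₁)) * (if Λ₀ i j ≠ 0 then |(Λ - Λ₀) i j| else 0) := by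
    simp only [onSupport, offSupport, Finset.sum_sub_distrib, ← Finset.mul_sum]
    ring
  rw [h5]
  refine add_le_add (Finset.sum_le_sum fun i _ => Finset.sum_le_sum fun j _ => ?_)
    (Finset.sum_le_sum fun i _ => Finset.sum_le_sum fun j _ => ?_)
  · refine (add_le_add_left (hT i j) _).trans (le_of_eq ?_)
    unfold penalty
    split_ifs <;> field_simp <;> ring
  · refine (add_le_add_left (hL i j) _).trans ?_
    have hd := abs_nonneg ((Λ - Λ₀) i j)
    unfold penalty
    split_ifs
    · have : |(Λ - Λ₀) i j| / ν₀ / 2 ≤ |(Λ - Λ₀) i j| / ν₀ := half_le_self (by positivity)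
      calc _ ≤ 1 / (2 * ν₁) * |(Λ - Λ₀) i j| + |(Λ - Λ₀) i j| / ν₀ := by gcongr
        _ = _ := by ring
    · exact le_of_eq (by field_simp; ring)

lemma onSupport_le (Θ₀ Θ : Matrix (Fin q) (Fin p) ℝ) (Λ₀ Λ : Matrix (Fin p) (Fin p) ℝ) :
    onSupport Θ₀ Θ Λ₀ Λ ≤
      Real.sqrt (sRow Θ₀ Λ₀) * Real.sqrt (frob (Θ - Θ₀) ^ 2 + frob (Λ - Λ₀) ^ 2) := by
  classical
  rw [← Real.sqrt_mul (Nat.cast_nonneg _)]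
  refine Real.le_sqrt_of_sq_le ?_
  have hcs := Finset.sum_mul_sq_le_sq_mul_sq
    (Finset.univ : Finset ((Fin q × Fin p) ⊕ (Fin p × Fin p)))
    (Sum.elim (fun ij => if ∃ k, Θ₀ ij.1 k ≠ 0 then 1 else 0)
      (fun ij => if Λ₀ ij.1 ij.2 ≠ 0 then 1 else 0))
    (Sum.elim (fun ij => |(Θ - Θ₀) ij.1 ij.2|) (fun ij => |(Λ - Λ₀) ij.1 ij.2|))
  simp only [Fintype.sum_sum_type, Sum.elim_inl, Sum.elim_inr, ite_pow, one_pow, ne_eq,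
    OfNat.ofNat_ne_zero, not_false_eq_true, zero_pow, sq_abs, ite_mul, one_mul, zero_mul] at hcs
  have hcard : (sRow Θ₀ Λ₀ : ℝ) = (∑ ij : Fin q × Fin p, if ∃ k, ¬ Θ₀ ij.1 k = 0 then (1 : ℝ) else 0)
      + ∑ ij : Fin p × Fin p, if ¬ Λ₀ ij.1 ij.2 = 0 then (1 : ℝ) else 0 := by
    rw [Finset.sum_boole, Finset.sum_boole, sRow, Set.ncard_eq_toFinset_card',
      Set.ncard_eq_toFinset_card']
    push_cast
    congr 3 <;> ext <;> simp
  rw [← hcard] at hcs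
  simp only [Fintype.sum_prod_type] at hcs
  rw [frob_sq, frob_sq]
  exact hcs

/-! ### Restricted isometry on the cone -/

lemma norm_toLp_sq {k : ℕ} (x : Fin k → ℝ) : ‖WithLp.toLp 2 x‖ ^ 2 = x ⬝ᵥ x := by
  rw [EuclideanSpace.real_norm_sq_eq]
  simp [dotProduct, sq]

lemma exists_subset_card_eq_forall_le {ι : Type*} [DecidableEq ι] (f : ι → ℝ) (S : Finset ι)
    (s : ℕ) (hs : s ≤ S.card) :
    ∃ T ⊆ S, T.card = s ∧ ∀ i ∈ S \ T, ∀ j ∈ T, f i ≤ f j := by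
  induction s with
  | zero => exact ⟨∅, by simp, by simp, by simp⟩
  | succ s ih =>
    obtain ⟨T, hTS, hcard, hT⟩ := ih (by omega)
    have hne : (S \ T).Nonempty := by
      rw [← Finset.card_pos, Finset.card_sdiff_of_subset hTS]
      omega
    obtain ⟨k, hk, hmax⟩ := Finset.exists_max_image (S \ T) f hne
    obtain ⟨hkS, hkT⟩ := Finset.mem_sdiff.1 hk
    refine ⟨insert k T, Finset.insert_subset hkS hTS, by
      rw [Finset.card_insert_of_notMem hkT, hcard], fun i hi j hj => ?_⟩
    simp only [Finset.mem_sdiff, Finset.mem_insert, not_or] at hi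
    have hi' : i ∈ S \ T := Finset.mem_sdiff.2 ⟨hi.1, hi.2.2⟩
    rcases Finset.mem_insert.1 hj with rfl | hj
    · exact hmax i hi'
    · exact hT i hi' j hj

lemma norm_toLp_le_of_sparse {s : ℕ} {v : Fin q → ℝ} {b : ℝ} (hv : {k | v k ≠ 0}.ncard ≤ s)
    (hb : ∀ i, |v i| ≤ b) (hb0 : 0 ≤ b) : ‖WithLp.toLp 2 v‖ ≤ Real.sqrt s * b := by
  classical
  refine abs_le_of_sq_le_sq' ?_ (by positivity) |>.2
  rw [EuclideanSpace.real_norm_sq_eq, mul_pow, Real.sq_sqrt (Nat.cast_nonneg _)]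
  have h1 : ∑ i, v i ^ 2 ≤ ∑ i, if v i ≠ 0 then b ^ 2 else 0 := by
    refine Finset.sum_le_sum fun i _ => ?_
    split_ifs with h
    · rw [← sq_abs]
      exact pow_le_pow_left₀ (abs_nonneg _) (hb i) 2
    · rw [not_not.1 h]; simp
  refine h1.trans ?_
  rw [← Finset.sum_filter, Finset.sum_const, nsmul_eq_mul]
  gcongr
  rw [Set.ncard_eq_toFinset_card'] at hv
  simpa using hv

lemma sum_abs_indicator (T : Finset (Fin q)) (v : Fin q → ℝ) :
    ∑ i, |(T : Set (Fin q)).indicator v i| = ∑ i ∈ T, |v i| := by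
  classical
  rw [← Finset.sum_filter_add_sum_filter_not Finset.univ (· ∈ T)]
  rw [Finset.sum_eq_zero (s := Finset.univ.filter (· ∉ T)), add_zero]
  · refine Finset.sum_congr (by ext; simp) fun i hi => ?_
    rw [Set.indicator_of_mem (by simpa using hi)]
  · intro i hi
    rw [Set.indicator_of_notMem (by simpa using hi), abs_zero]

lemma sum_abs_indicator_compl (T : Finset (Fin q)) (v : Fin q → ℝ) :
    ∑ i, |(T : Set (Fin q))ᶜ.indicator v i| = ∑ i, |v i| - ∑ i ∈ T, |v i| := by
  classical
  rw [← Finset.coe_compl, sum_abs_indicator, eq_sub_iff_add_eq, Finset.sum_compl_add_sum]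

lemma norm_mulVec_le_indicator_add (A : Matrix (Fin n) (Fin q) ℝ) (T : Finset (Fin q))
    (v : Fin q → ℝ) : ‖WithLp.toLp 2 (A *ᵥ v)‖ ≤
      ‖WithLp.toLp 2 (A *ᵥ (T : Set (Fin q)).indicator v)‖
        + ‖WithLp.toLp 2 (A *ᵥ (T : Set (Fin q))ᶜ.indicator v)‖ := by
  have h : A *ᵥ v = A *ᵥ (T : Set (Fin q)).indicator v + A *ᵥ (T : Set (Fin q))ᶜ.indicator v := by
    rw [← mulVec_add, Set.indicator_self_add_compl]
  rw [h, WithLp.toLp_add]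
  exact norm_add_le _ _

lemma sqrt_mul_div_self (a b : ℝ) : Real.sqrt b * (a / b) = a / Real.sqrt b := by
  rw [mul_div_left_comm, Real.sqrt_div_self, div_eq_mul_inv]

/-- Peeling off the `s` largest entries again and again: a matrix that is bounded on `s`-sparse
vectors is bounded on all vectors by a mixture of the `ℓ^∞` and the `ℓ¹` norm. -/
lemma norm_mulVec_le_of_bounded {A : Matrix (Fin n) (Fin q) ℝ} {c : ℝ} (hc : 0 ≤ c) {s : ℕ}
    (hs : 0 < s) (hA : ∀ u : Fin q → ℝ, {k | u k ≠ 0}.ncard ≤ s →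
      ‖WithLp.toLp 2 (A *ᵥ u)‖ ≤ c * ‖WithLp.toLp 2 u‖) (m : ℕ) :
    ∀ (v : Fin q → ℝ) (b : ℝ), 0 ≤ b → {k | v k ≠ 0}.ncard ≤ m → (∀ i, |v i| ≤ b) →
      ‖WithLp.toLp 2 (A *ᵥ v)‖ ≤ c * (Real.sqrt s * b + (∑ i, |v i|) / Real.sqrt s) := by
  classical
  have hs0 : (0 : ℝ) < s := by exact_mod_cast hs
  have hsparse : ∀ (v : Fin q → ℝ) (b : ℝ), 0 ≤ b → {k | v k ≠ 0}.ncard ≤ s →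
      (∀ i, |v i| ≤ b) → ‖WithLp.toLp 2 (A *ᵥ v)‖ ≤ c * (Real.sqrt s * b) :=
    fun v b hb hv hvb => (hA v hv).trans
      (mul_le_mul_of_nonneg_left (norm_toLp_le_of_sparse hv hvb hb) hc)
  induction m with
  | zero =>
    intro v b hb hv hvb
    refine (hsparse v b hb (by omega) hvb).trans (mul_le_mul_of_nonneg_left ?_ hc)
    exact le_add_of_nonneg_right (by positivity)
  | succ m ih =>
    intro v b hb hv hvb
    by_cases hvs : {k | v k ≠ 0}.ncard ≤ s
    · refine (hsparse v b hb hvs hvb).trans (mul_le_mul_of_nonneg_left ?_ hc)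
      exact le_add_of_nonneg_right (by positivity)
    have hcard : {k | v k ≠ 0}.ncard = (Finset.univ.filter fun k => v k ≠ 0).card := by
      rw [Set.ncard_eq_toFinset_card']
      simp
    obtain ⟨T, hTS, hTc, hT⟩ := exists_subset_card_eq_forall_le (fun i => |v i|)
      (Finset.univ.filter fun k => v k ≠ 0) s (by omega)
    -- the entries outside `T` are at most the average over `T`
    have havg : ∀ i, |(T : Set (Fin q))ᶜ.indicator v i| ≤ (∑ j ∈ T, |v j|) / s := by
      intro i
      by_cases hi : i ∈ T
      · rw [Set.indicator_of_notMem (by simpa using hi), abs_zero]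
        positivity
      rw [Set.indicator_of_mem (by simpa using hi), le_div_iff₀ hs0]
      by_cases hvi : v i = 0
      · rw [hvi, abs_zero, zero_mul]
        positivity
      have := Finset.card_nsmul_le_sum T (fun j => |v j|) |v i|
        fun j hj => hT i (by simp [hvi, hi]) j hj
      rw [hTc, nsmul_eq_mul] at this
      linarith
    have h1 : ‖WithLp.toLp 2 (A *ᵥ (T : Set (Fin q)).indicator v)‖ ≤ c * (Real.sqrt s * b) := by
      refine hsparse _ b hb ?_ fun i => ?_
      · rw [← hTc, ← Set.ncard_coe_finset]
        exact Set.ncard_le_ncard fun k hk => Set.mem_of_indicator_ne_zero hk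
      · by_cases hi : i ∈ T
        · rw [Set.indicator_of_mem (by simpa using hi)]
          exact hvb i
        · rw [Set.indicator_of_notMem (by simpa using hi), abs_zero]
          exact hb
    have h2 := ih ((T : Set (Fin q))ᶜ.indicator v) ((∑ j ∈ T, |v j|) / s) (by positivity) (by
        have hsub : {k | (T : Set (Fin q))ᶜ.indicator v k ≠ 0}
            ⊆ (((Finset.univ.filter fun k => v k ≠ 0) \ T : Finset (Fin q)) : Set (Fin q)) := by
          intro k hk
          have hkT := Set.mem_of_indicator_ne_zero hk
          rw [Set.mem_ofPred_eq, Set.indicator_of_mem hkT] at hk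
          simpa using ⟨hk, hkT⟩
        have := Set.ncard_le_ncard hsub
        rw [Set.ncard_coe_finset, Finset.card_sdiff_of_subset hTS] at this
        omega) havg
    have h3 := norm_mulVec_le_indicator_add A T v
    rw [sum_abs_indicator_compl] at h2
    rw [sqrt_mul_div_self, ← add_div, add_sub_cancel] at h2
    linarith

/-- The entries outside the `s` largest ones are at most the average of those, so that the mixed
bound collapses to the `ℓ¹` norm. The set of entries does not depend on the matrix. -/
lemma exists_norm_mulVec_indicator_compl_le (v : Fin q → ℝ) {s : ℕ} (hs : 0 < s) :
    ∃ T : Finset (Fin q), T.card ≤ s ∧ ∀ {n : ℕ} (A : Matrix (Fin n) (Fin q) ℝ) (c : ℝ), 0 ≤ c →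
      (∀ u : Fin q → ℝ, {k | u k ≠ 0}.ncard ≤ s →
        ‖WithLp.toLp 2 (A *ᵥ u)‖ ≤ c * ‖WithLp.toLp 2 u‖) →
      ‖WithLp.toLp 2 (A *ᵥ (T : Set (Fin q))ᶜ.indicator v)‖ ≤
        c * ((∑ i, |v i|) / Real.sqrt s) := by
  classical
  have hs0 : (0 : ℝ) < s := by exact_mod_cast hs
  rcases le_total s q with hq | hq
  · obtain ⟨T, -, hTc, hT⟩ := exists_subset_card_eq_forall_le (fun i => |v i|)
      Finset.univ s (by simpa using hq)
    refine ⟨T, hTc.le, fun A c hc hA => ?_⟩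
    have havg : ∀ i, |(T : Set (Fin q))ᶜ.indicator v i| ≤ (∑ j ∈ T, |v j|) / s := by
      intro i
      by_cases hi : i ∈ T
      · rw [Set.indicator_of_notMem (by simpa using hi), abs_zero]
        positivity
      rw [Set.indicator_of_mem (by simpa using hi), le_div_iff₀ hs0]
      have := Finset.card_nsmul_le_sum T (fun j => |v j|) |v i|
        fun j hj => hT i (by simp [hi]) j hj
      rw [hTc, nsmul_eq_mul] at this
      linarith
    have h2 := norm_mulVec_le_of_bounded hc hs hA _ _ _ (by positivity) le_rfl havg
    rw [sum_abs_indicator_compl] at h2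
    rwa [sqrt_mul_div_self, ← add_div, add_sub_cancel] at h2
  · refine ⟨Finset.univ, by simpa using hq, fun A c hc _ => ?_⟩
    have h0 : ((Finset.univ : Finset (Fin q)) : Set (Fin q))ᶜ.indicator v = 0 := by
      rw [Finset.coe_univ, Set.compl_univ]
      exact Set.indicator_empty' v
    rw [h0, mulVec_zero, WithLp.toLp_zero, norm_zero]
    positivity

lemma norm_mulVec_le_of_sq_le {A : Matrix (Fin n) (Fin q) ℝ} {r : ℝ} (hr : 0 ≤ r) {u : Fin q → ℝ}
    (h : (A *ᵥ u) ⬝ᵥ (A *ᵥ u) ≤ r * (u ⬝ᵥ u)) :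
    ‖WithLp.toLp 2 (A *ᵥ u)‖ ≤ Real.sqrt r * ‖WithLp.toLp 2 u‖ := by
  refine abs_le_of_sq_le_sq' ?_ (by positivity) |>.2
  rwa [mul_pow, Real.sq_sqrt hr, norm_toLp_sq, norm_toLp_sq]

/-- A lower bound under restricted isometry: off the rows in `R`, only the `ℓ¹` norm enters. -/
lemma le_frob_mul_of_sparse {A : Matrix (Fin n) (Fin q) ℝ} {r₁ r₂ : ℝ} (hr₁ : 0 ≤ r₁)
    (hr₂ : 0 ≤ r₂) {k s : ℕ} (hs : 0 < s)
    (hlow : ∀ u : Fin q → ℝ, {i | u i ≠ 0}.ncard ≤ k + s →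
      r₁ * (u ⬝ᵥ u) ≤ (A *ᵥ u) ⬝ᵥ (A *ᵥ u))
    (hupp : ∀ u : Fin q → ℝ, {i | u i ≠ 0}.ncard ≤ k + s →
      (A *ᵥ u) ⬝ᵥ (A *ᵥ u) ≤ r₂ * (u ⬝ᵥ u))
    (R : Finset (Fin q)) (hR : R.card ≤ k) (U : Matrix (Fin q) (Fin p) ℝ) :
    Real.sqrt r₁ * (frob U - (∑ j, ∑ i ∈ Rᶜ, |U i j|) / Real.sqrt s)
      - Real.sqrt r₂ * ((∑ j, ∑ i ∈ Rᶜ, |U i j|) / Real.sqrt s) ≤ frob (A * U) := by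
  classical
  set l : Fin p → ℝ := fun j => ∑ i ∈ Rᶜ, |U i j| with hl
  have hl0 : ∀ j, 0 ≤ l j := fun j => Finset.sum_nonneg fun _ _ => abs_nonneg _
  have hl1 : ∀ j, ∑ i, |(R : Set (Fin q))ᶜ.indicator (U.col j) i| = l j := by
    intro j
    rw [← Finset.coe_compl, sum_abs_indicator]
    rfl
  choose T hTc hT using fun j =>
    exists_norm_mulVec_indicator_compl_le ((R : Set (Fin q))ᶜ.indicator (U.col j)) hs
  -- the tail of `U`: in each column, what lies off `R` and off the `s` largest entries there
  set U₂ : Matrix (Fin q) (Fin p) ℝ := Matrix.of fun i j =>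
    (T j : Set (Fin q))ᶜ.indicator ((R : Set (Fin q))ᶜ.indicator (U.col j)) i with hU₂
  have hcol : ∀ j, U₂.col j =
    (T j : Set (Fin q))ᶜ.indicator ((R : Set (Fin q))ᶜ.indicator (U.col j)) := fun j => rfl
  have hsq : ∑ j, l j ^ 2 ≤ (∑ j, l j) ^ 2 := Finset.sum_sq_le_sq_sum_of_nonneg fun j _ => hl0 j
  have hL0 : 0 ≤ ∑ j, l j := Finset.sum_nonneg fun j _ => hl0 j
  have htail : ∀ {m : ℕ} (G : Matrix (Fin m) (Fin q) ℝ) (c : ℝ), 0 ≤ c →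
      (∀ u : Fin q → ℝ, {k | u k ≠ 0}.ncard ≤ s →
        ‖WithLp.toLp 2 (G *ᵥ u)‖ ≤ c * ‖WithLp.toLp 2 u‖) →
      frob (G * U₂) ≤ c * ((∑ j, l j) / Real.sqrt s) := by
    intro m G c hc hG
    refine abs_le_of_sq_le_sq' ?_ (by positivity) |>.2
    rw [frob_mul_sq_eq_sum_col]
    calc ∑ j, (G *ᵥ U₂.col j) ⬝ᵥ (G *ᵥ U₂.col j)
        ≤ ∑ j, (c * (l j / Real.sqrt s)) ^ 2 := by
          refine Finset.sum_le_sum fun j _ => ?_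
          rw [← norm_toLp_sq, hcol, ← hl1]
          exact pow_le_pow_left₀ (norm_nonneg _) (hT j G c hc hG) 2
      _ = (c / Real.sqrt s) ^ 2 * ∑ j, l j ^ 2 := by
          rw [Finset.mul_sum]
          exact Finset.sum_congr rfl fun j _ => by ring
      _ ≤ (c / Real.sqrt s) ^ 2 * (∑ j, l j) ^ 2 := by gcongr
      _ = _ := by ring
  have h1 : frob U₂ ≤ (∑ j, l j) / Real.sqrt s := by
    have := htail (1 : Matrix (Fin q) (Fin q) ℝ) 1 zero_le_one (fun u _ => by simp)
    simpa using this
  have h2 : frob (A * U₂) ≤ Real.sqrt r₂ * ((∑ j, l j) / Real.sqrt s) :=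
    htail A _ (Real.sqrt_nonneg _) fun u hu => norm_mulVec_le_of_sq_le hr₂ (hupp u (by omega))
  have h3 : Real.sqrt r₁ * frob (U - U₂) ≤ frob (A * (U - U₂)) := by
    refine abs_le_of_sq_le_sq' ?_ (frob_nonneg _) |>.2
    rw [mul_pow, Real.sq_sqrt hr₁, frob_mul_sq_eq_sum_col, frob_sq_eq_sum_col, Finset.mul_sum]
    refine Finset.sum_le_sum fun j _ => hlow _ ?_
    have hsub : {i | (U - U₂).col j i ≠ 0} ⊆ ((R ∪ T j : Finset (Fin q)) : Set (Fin q)) := by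
      intro i hi
      by_contra hn
      simp only [Finset.coe_union, Set.mem_union, Finset.mem_coe, not_or] at hn
      refine hi ?_
      have : U₂ i j = U i j := by
        rw [hU₂, Matrix.of_apply, Set.indicator_of_mem (by simpa using hn.2),
          Set.indicator_of_mem (by simpa using hn.1)]
        rfl
      simp [Matrix.col, this]
    have := Set.ncard_le_ncard hsub
    rw [Set.ncard_coe_finset] at this
    have := Finset.card_union_le R (T j)
    have := hTc j
    omega
  have h4 : frob U - frob U₂ ≤ frob (U - U₂) := by
    simpa [sub_eq_add_neg, frob_neg] using le_frob_add U (-U₂)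
  have h5 : frob (A * (U - U₂)) ≤ frob (A * U) + frob (A * U₂) := by
    rw [Matrix.mul_sub]
    exact frob_sub_le _ _
  have h6 : Real.sqrt r₁ * (frob U - (∑ j, l j) / Real.sqrt s) ≤ Real.sqrt r₁ * frob (U - U₂) :=
    mul_le_mul_of_nonneg_left (by linarith) (Real.sqrt_nonneg _)
  linarith

/-- Numerical consequence on the cone. Here `t`, `l` are the norms of the deviations of `Θ`, `Λ`,
and `N` is the number of relevant entries. -/
lemma sq_le_of_cone {r₁ r₂ α N s t l L F : ℝ} (hr₁ : 0 < r₁) (hr : 3 * r₁ ≤ r₂) (hN : 0 ≤ N)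
    (hs : 0 < s) (hsN : 4 * (r₂ / r₁) * α ^ 2 * N ≤ s) (ht : 0 ≤ t) (hl : 0 ≤ l) (hL : 0 ≤ L)
    (hcone : L ≤ α * (Real.sqrt N * Real.sqrt (t ^ 2 + l ^ 2)))
    (hF : Real.sqrt r₁ * (t - L / Real.sqrt s) - Real.sqrt r₂ * (L / Real.sqrt s) ≤ F) : r₁ * (t ^ 2 / 50 - 0.65 * l ^ 2) ≤ F ^ 2 := by
  have hr₂ : 0 < r₂ := by linarith
  have hL2 : L ^ 2 ≤ α ^ 2 * N * (t ^ 2 + l ^ 2) := by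
    calc L ^ 2 ≤ (α * (Real.sqrt N * Real.sqrt (t ^ 2 + l ^ 2))) ^ 2 := by gcongr
      _ = α ^ 2 * Real.sqrt N ^ 2 * Real.sqrt (t ^ 2 + l ^ 2) ^ 2 := by ring
      _ = _ := by rw [Real.sq_sqrt hN, Real.sq_sqrt (by positivity)]
  have hLs : (L / Real.sqrt s) ^ 2 ≤ r₁ / r₂ / 4 * (t ^ 2 + l ^ 2) := by
    rw [div_pow, Real.sq_sqrt hs.le, div_le_iff₀ hs]
    calc L ^ 2 ≤ α ^ 2 * N * (t ^ 2 + l ^ 2) := hL2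
      _ = r₁ / r₂ / 4 * (t ^ 2 + l ^ 2) * (4 * (r₂ / r₁) * α ^ 2 * N) := by field_simp
      _ ≤ _ := by gcongr
  have hsq : t ^ 2 + l ^ 2 ≤ (t + l) ^ 2 := by nlinarith [mul_nonneg ht hl]
  -- `0.29 ^ 2` is just above `1 / 12`
  have h1 : L / Real.sqrt s ≤ 0.29 * (t + l) := by
    refine abs_le_of_sq_le_sq' ?_ (by positivity) |>.2
    have h2 : r₁ / r₂ ≤ 1 / 3 := by rw [div_le_iff₀ hr₂]; linarith
    calc _ ≤ r₁ / r₂ / 4 * (t ^ 2 + l ^ 2) := hLs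
      _ ≤ 1 / 3 / 4 * (t + l) ^ 2 := by gcongr
      _ ≤ _ := by nlinarith [sq_nonneg (t + l)]
  have h2 : Real.sqrt r₂ * (L / Real.sqrt s) ≤ Real.sqrt r₁ * (0.5 * (t + l)) := by
    refine abs_le_of_sq_le_sq' ?_ (by positivity) |>.2
    rw [mul_pow, mul_pow, Real.sq_sqrt hr₁.le, Real.sq_sqrt hr₂.le]
    calc _ ≤ r₂ * (r₁ / r₂ / 4 * (t ^ 2 + l ^ 2)) := by gcongr
      _ = r₁ / 4 * (t ^ 2 + l ^ 2) := by field_simp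
      _ ≤ r₁ / 4 * (t + l) ^ 2 := by gcongr
      _ = _ := by ring
  have h3 : Real.sqrt r₁ * (0.21 * t - 0.79 * l) ≤ F := by
    have := mul_le_mul_of_nonneg_left h1 (Real.sqrt_nonneg r₁)
    linarith
  have h4 : Real.sqrt r₁ * (0.21 * t) ≤ F + Real.sqrt r₁ * (0.79 * l) := by linarith
  have h5 := pow_le_pow_left₀ (by positivity) h4 2
  have h6 := Real.sq_sqrt hr₁.le
  have h7 : r₁ * (0.21 * t) ^ 2 ≤ 2 * F ^ 2 + 2 * (r₁ * (0.79 * l) ^ 2) := by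
    calc r₁ * (0.21 * t) ^ 2 = (Real.sqrt r₁ * (0.21 * t)) ^ 2 := by
          rw [mul_pow (Real.sqrt r₁), h6]
      _ ≤ (F + Real.sqrt r₁ * (0.79 * l)) ^ 2 := h5
      _ ≤ 2 * F ^ 2 + 2 * (Real.sqrt r₁ * (0.79 * l)) ^ 2 := by
          nlinarith [sq_nonneg (F - Real.sqrt r₁ * (0.79 * l))]
      _ = _ := by rw [mul_pow (Real.sqrt r₁), h6]
  have h8 : 0 ≤ r₁ * t ^ 2 := by positivity
  have h9 : 0 ≤ r₁ * l ^ 2 := by positivity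
  nlinarith

/-! ### The estimation error on the high posterior density region -/

lemma empMoment_self_eq_transpose_mul (x : Fin n → Fin q → ℝ) :
    empMoment x x = (Matrix.of fun i j => x i j / Real.sqrt n)ᵀ
      * (Matrix.of fun i j => x i j / Real.sqrt n) := by
  ext j k
  simp only [empMoment, Matrix.smul_apply, Matrix.sum_apply, vecMulVec_apply, Matrix.mul_apply,
    transpose_apply, of_apply, smul_eq_mul, Finset.mul_sum]
  refine Finset.sum_congr rfl fun i _ => ?_
  rw [div_mul_div_comm, Real.mul_self_sqrt (Nat.cast_nonneg _)]
  ring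

lemma isHermitian_transpose_mul_mul {S : Matrix (Fin q) (Fin q) ℝ} (hS : S.IsHermitian)
    (Θ : Matrix (Fin q) (Fin p) ℝ) : (Θᵀ * S * Θ).IsHermitian :=
  isHermitian_conjTranspose_mul_mul Θ hS

lemma lamTheta_pos {Sig : Matrix (Fin q) (Fin q) ℝ} (hSig : Sig.PosDef)
    {Θ₀ : Matrix (Fin q) (Fin p) ℝ} (hΘ₀ : Θ₀ ≠ 0) : 0 < lamTheta Sig Θ₀ := by
  obtain ⟨x, hx⟩ : ∃ x, Θ₀ *ᵥ x ≠ 0 := by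
    by_contra hn
    push Not at hn
    exact hΘ₀ (ext_of_mulVec_single fun i => by rw [hn, zero_mulVec])
  have h1 := dotProduct_mulVec_le_lamMax (isHermitian_transpose_mul_mul hSig.1 Θ₀) x
  have h2 : 0 < x ⬝ᵥ ((Θ₀ᵀ * Sig * Θ₀) *ᵥ x) := by
    rw [← mulVec_mulVec, ← mulVec_mulVec, dotProduct_mulVec x, vecMul_transpose]
    simpa using hSig.dotProduct_mulVec_pos hx
  have h3 : 0 ≤ x ⬝ᵥ x := by
    rw [← norm_toLp_sq]
    positivity
  by_contra! hle
  exact absurd (h2.trans_le h1) (not_lt.2 (mul_nonpos_of_nonpos_of_nonneg hle h3))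

lemma restrictedIsometry_bounds {s : ℕ} {x : Fin n → Fin q → ℝ} {Sig : Matrix (Fin q) (Fin q) ℝ}
    {Θ₀ : Matrix (Fin q) (Fin p) ℝ} (hSig : Sig.PosDef) (h : RestrictedIsometry s x Sig Θ₀)
    {u : Fin q → ℝ} (hu : {k | u k ≠ 0}.ncard ≤ s) :
    0.5 * lamMin Sig * (u ⬝ᵥ u) ≤ u ⬝ᵥ (empMoment x x *ᵥ u) ∧
      u ⬝ᵥ (empMoment x x *ᵥ u) ≤ 1.5 * lamMax Sig * (u ⬝ᵥ u) := by
  rcases eq_or_ne u 0 with rfl | hu0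
  · simp
  obtain ⟨h1, h2⟩ := h.1 u hu0 hu
  have hpos : 0 < u ⬝ᵥ (Sig *ᵥ u) := by simpa using hSig.dotProduct_mulVec_pos hu0
  rw [le_div_iff₀ hpos] at h1
  rw [div_le_iff₀ hpos] at h2
  have h3 := dotProduct_mulVec_le_lamMax hSig.1 u
  have h4 := lamMin_mul_le_dotProduct_mulVec hSig.1 u
  constructor <;> linarith

lemma card_rows_le_sRow (hp : 0 < p) (Θ₀ : Matrix (Fin q) (Fin p) ℝ)
    (Λ₀ : Matrix (Fin p) (Fin p) ℝ) (R : Finset (Fin q)) (hR : ∀ i ∈ R, ∃ k, Θ₀ i k ≠ 0) :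
    R.card ≤ sRow Θ₀ Λ₀ := by
  refine le_trans ?_ (Nat.le_add_right _ _)
  rw [← Set.ncard_coe_finset]
  refine Set.ncard_le_ncard_of_injOn (fun i => (i, ⟨0, hp⟩)) (fun i hi => hR i (by simpa using hi))
    (fun i _ j _ hij => (Prod.mk.inj hij).1)

lemma sRow_pos (hp : 0 < p) (Θ₀ : Matrix (Fin q) (Fin p) ℝ)
    {Λ₀ : Matrix (Fin p) (Fin p) ℝ} (h₀ : Λ₀.PosDef) : 0 < sRow Θ₀ Λ₀ := by
  refine Nat.add_pos_right _ ((Set.ncard_pos).2 ⟨(⟨0, hp⟩, ⟨0, hp⟩), ?_⟩)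
  exact h₀.diag_pos.ne'

/-- The choice of weights that combines the curvature in `Λ` with that in `Θ`. Here `t`, `l` are
the norms of the deviations of `Θ`, `Λ`, `F` is the prediction norm of the former, `μ` the norm
of the latter relative to `Λ₀`, `M` and `m / 3` are bounds for the eigenvalues of `Λ₀` from above
and below, and `W = min 1 (m / (16 T))`. -/
lemma combine_curvature {t l F μ M m T r W D : ℝ} (hM : 0 < M) (hm : 0 < m) (hT : 0 < T)
    (hr : 0 < r) (hrM : r ≤ 0.5 * M⁻¹) (hW0 : 0 ≤ W) (hW1 : W ≤ 1) (hWT : W ≤ m / (16 * T))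
    (hl : l ^ 2 ≤ M ^ 2 * μ ^ 2) (hF : r * (t ^ 2 / 50 - 0.65 * l ^ 2) ≤ F ^ 2)
    (hD : ∀ w : ℝ, 0 ≤ w → w ≤ 1 →
      μ ^ 2 / 2 + w * (F ^ 2 / (2 * M) - 1.4 * T / (m / 3) * μ ^ 2) ≤ D) :
    r / (40 * M) * W / 5 * (t ^ 2 + l ^ 2) ≤ D := by
  -- `w = W / 2` keeps the loss `1.4 T / (m / 3) * w` below `1 / 7`
  refine le_trans ?_ (hD (W / 2) (by positivity) (by linarith))
  have h1 : W / 2 * (1.4 * T / (m / 3) * μ ^ 2) ≤ 0.14 * μ ^ 2 := by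
    calc W / 2 * (1.4 * T / (m / 3) * μ ^ 2)
        ≤ (m / (16 * T)) / 2 * (1.4 * T / (m / 3) * μ ^ 2) := by gcongr
      _ = 0.13125 * μ ^ 2 := by field_simp; ring
      _ ≤ _ := by nlinarith [sq_nonneg μ]
  have h2 : W / 2 * (r * (t ^ 2 / 50 - 0.65 * l ^ 2) / (2 * M)) ≤ W / 2 * (F ^ 2 / (2 * M)) := by
    gcongr
  have h3 : W * r / M * l ^ 2 ≤ 0.5 * μ ^ 2 := by
    calc W * r / M * l ^ 2 ≤ 1 * (0.5 * M⁻¹) / M * (M ^ 2 * μ ^ 2) := by gcongr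
      _ = _ := by field_simp
  have h4 : W / 2 * (r * (t ^ 2 / 50 - 0.65 * l ^ 2) / (2 * M))
      = r / (40 * M) * W / 5 * t ^ 2 - 0.1625 * (W * r / M * l ^ 2) := by
    field_simp; ring
  have h5 : r / (40 * M) * W / 5 * l ^ 2 = (W * r / M * l ^ 2) / 200 := by
    field_simp; ring
  have h6 := sq_nonneg μ
  nlinarith

/-- On the cone the divergence has curvature `β₀ / 5`, up to the factor `V`. -/
lemma lik_curvature (hp : 0 < p) (hq : 0 < q) {Sig : Matrix (Fin q) (Fin q) ℝ}
    {Θ₀ Θ : Matrix (Fin q) (Fin p) ℝ} {Λ₀ Λ : Matrix (Fin p) (Fin p) ℝ} (hSig : Sig.PosDef)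
    (hΛ₀ : Λ₀.PosDef) (hΛ : Λ.PosDef) (hΘ₀ : Θ₀ ≠ 0) {ν₀ ν₁ : ℝ} (h₀ : 0 < ν₀) (h₁ : 0 < ν₁)
    {x : Fin n → Fin q → ℝ} (hx : RestrictedIsometry (sZero ν₀ ν₁ Sig Θ₀ Λ₀) x Sig Θ₀)
    (hcone : offSupport Θ₀ Θ ≤ coneAlpha ν₀ ν₁ * onSupport Θ₀ Θ Λ₀ Λ) :
    betaZero Sig Θ₀ Λ₀ / 5 * (frob (Θ - Θ₀) ^ 2 + frob (Λ - Λ₀) ^ 2) ≤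
      (1 + frob Λ₀⁻¹ * frob (Λ - Λ₀)) * likDiv (empMoment x x) Θ₀ Θ Λ₀ Λ := by
  classical
  set A : Matrix (Fin n) (Fin q) ℝ := Matrix.of fun i j => x i j / Real.sqrt n with hA
  have hS : empMoment x x = Aᵀ * A := empMoment_self_eq_transpose_mul x
  have hM : 0 < lamMax Λ₀ := (lamMin_pos hp hΛ₀).trans_le (lamMin_le_lamMax hp hΛ₀.1)
  have h3Λ : ((3 : ℝ) • Λ₀).PosDef := hΛ₀.smul (by norm_num)
  have hm := lamMin_pos hp h3Λ
  have hT := lamTheta_pos hSig hΘ₀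
  have hσ₁ := lamMin_pos hq hSig
  have hσ := lamMin_le_lamMax hq hSig.1
  have hα : 0 < coneAlpha ν₀ ν₁ := by unfold coneAlpha; positivity
  have hr₁ : 0 < rhoOne Sig Λ₀ := by
    have : 0 < min (lamMax Λ₀)⁻¹ (lamMin Sig) := lt_min (by positivity) hσ₁
    unfold rhoOne
    positivity
  have hr₁M : rhoOne Sig Λ₀ ≤ 0.5 * (lamMax Λ₀)⁻¹ := by
    unfold rhoOne
    gcongr
    exact min_le_left _ _
  have hr₁σ : rhoOne Sig Λ₀ ≤ 0.5 * lamMin Sig := by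
    unfold rhoOne
    gcongr
    exact min_le_right _ _
  have hr₂ : rhoTwo Sig = 1.5 * lamMax Sig := rfl
  have hlow : ∀ v, lamMin ((3 : ℝ) • Λ₀) / 3 * (v ⬝ᵥ v) ≤ v ⬝ᵥ (Λ₀ *ᵥ v) := by
    intro v
    have := lamMin_mul_le_dotProduct_mulVec h3Λ.1 v
    rw [smul_mulVec, dotProduct_smul, smul_eq_mul] at this
    linarith
  have hΘA : ∀ v, ((A * Θ₀) *ᵥ v) ⬝ᵥ ((A * Θ₀) *ᵥ v) ≤ 1.4 * lamTheta Sig Θ₀ * (v ⬝ᵥ v) := by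
    intro v
    have h1 : lamTheta (empMoment x x) Θ₀ ≤ 1.4 * lamTheta Sig Θ₀ := (div_le_iff₀ hT).1 hx.2
    have h2 := dotProduct_mulVec_le_lamMax (isHermitian_transpose_mul_mul
      (show (empMoment x x).IsHermitian from empMoment_self_transpose x) Θ₀) v
    have h3 : ((A * Θ₀) *ᵥ v) ⬝ᵥ ((A * Θ₀) *ᵥ v) = v ⬝ᵥ ((Θ₀ᵀ * empMoment x x * Θ₀) *ᵥ v) := by
      rw [← dotProduct_transpose_mul_self_mulVec, hS, transpose_mul]
      simp only [Matrix.mul_assoc]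
    rw [h3]
    refine h2.trans (mul_le_mul_of_nonneg_right h1 ?_)
    rw [← norm_toLp_sq]
    positivity
  obtain ⟨μ, hμ, hdiv⟩ := exists_le_likDiv hΛ₀ hΛ A Θ₀ Θ (by positivity) hM (by positivity) hlow
    (dotProduct_mulVec_le_lamMax hΛ₀.1) hΘA
  rw [← hS] at hdiv
  have hN : (0 : ℝ) < sRow Θ₀ Λ₀ := by exact_mod_cast sRow_pos hp Θ₀ hΛ₀
  set s := ⌈4 * (rhoTwo Sig / rhoOne Sig Λ₀) * coneAlpha ν₀ ν₁ ^ 2 * (sRow Θ₀ Λ₀ : ℝ)⌉₊ with hs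
  have hs0 : sZero ν₀ ν₁ Sig Θ₀ Λ₀ = sRow Θ₀ Λ₀ + s := rfl
  have hspos : 0 < s := Nat.ceil_pos.2 (by rw [hr₂]; have := hσ₁.trans_le hσ; positivity)
  set R : Finset (Fin q) := Finset.univ.filter fun i => ∃ k, Θ₀ i k ≠ 0 with hR
  have hoff : offSupport Θ₀ Θ = ∑ j, ∑ i ∈ Rᶜ, |(Θ - Θ₀) i j| := by
    rw [offSupport, Finset.sum_comm]
    refine Finset.sum_congr rfl fun j _ => ?_
    rw [hR, Finset.compl_filter, Finset.sum_filter]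
    refine Finset.sum_congr rfl fun i _ => ?_
    split_ifs <;> rfl
  have hsp := le_frob_mul_of_sparse (A := A) hr₁.le (by rw [hr₂]; linarith : 0 ≤ rhoTwo Sig)
    (k := sRow Θ₀ Λ₀) hspos
    (fun u hu => by
      have := (restrictedIsometry_bounds hSig hx (hs0 ▸ hu)).1
      rw [hS, dotProduct_transpose_mul_self_mulVec] at this
      refine le_trans (mul_le_mul_of_nonneg_right hr₁σ ?_) this
      rw [← norm_toLp_sq]
      positivity)
    (fun u hu => by
      have := (restrictedIsometry_bounds hSig hx (hs0 ▸ hu)).2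
      rwa [hS, dotProduct_transpose_mul_self_mulVec] at this)
    R (card_rows_le_sRow hp Θ₀ Λ₀ R fun i hi => by simpa [hR] using hi) (Θ - Θ₀)
  rw [← hoff] at hsp
  have hF := sq_le_of_cone hr₁ (by rw [hr₂]; linarith : 3 * rhoOne Sig Λ₀ ≤ rhoTwo Sig) hN.le
    (by exact_mod_cast hspos : (0 : ℝ) < s) (Nat.le_ceil _) (frob_nonneg (Θ - Θ₀))
    (frob_nonneg (Λ - Λ₀)) (hoff ▸ by positivity)
    (hcone.trans (mul_le_mul_of_nonneg_left (onSupport_le Θ₀ Θ Λ₀ Λ) hα.le)) hsp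
  exact combine_curvature hM hm hT hr₁ hr₁M (by positivity) (min_le_left _ _) (min_le_right _ _)
    hμ hF hdiv

lemma likDiv_nonneg (hp : 0 < p) {Λ₀ Λ : Matrix (Fin p) (Fin p) ℝ} (hΛ₀ : Λ₀.PosDef) (hΛ : Λ.PosDef)
    (x : Fin n → Fin q → ℝ) (Θ₀ Θ : Matrix (Fin q) (Fin p) ℝ) :
    0 ≤ likDiv (empMoment x x) Θ₀ Θ Λ₀ Λ := by
  rw [empMoment_self_eq_transpose_mul]
  set A : Matrix (Fin n) (Fin q) ℝ := Matrix.of fun i j => x i j / Real.sqrt n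
  have hm := lamMin_pos hp hΛ₀
  have hherm : ((A * Θ₀)ᵀ * (A * Θ₀)).IsHermitian := isHermitian_conjTranspose_mul_self (A * Θ₀)
  obtain ⟨μ, -, h⟩ := exists_le_likDiv hΛ₀ hΛ A Θ₀ Θ hm
    (hm.trans_le (lamMin_le_lamMax hp hΛ₀.1))
    (le_max_left 0 (lamMax ((A * Θ₀)ᵀ * (A * Θ₀)))) (lamMin_mul_le_dotProduct_mulVec hΛ₀.1)
    (dotProduct_mulVec_le_lamMax hΛ₀.1) fun v => by
      rw [← dotProduct_transpose_mul_self_mulVec]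
      refine (dotProduct_mulVec_le_lamMax hherm v).trans
        (mul_le_mul_of_nonneg_right (le_max_right _ _) ?_)
      rw [← norm_toLp_sq]
      positivity
  have h1 := h 0 le_rfl zero_le_one
  rw [zero_mul, add_zero] at h1
  have hV : 0 < 1 + frob Λ₀⁻¹ * frob (Λ - Λ₀) := by
    have := mul_nonneg (frob_nonneg Λ₀⁻¹) (frob_nonneg (Λ - Λ₀))
    linarith
  exact nonneg_of_mul_nonneg_right ((by positivity : (0 : ℝ) ≤ μ ^ 2 / 2).trans h1) hV

lemma betaZero_pos (hp : 0 < p) (hq : 0 < q) {Sig : Matrix (Fin q) (Fin q) ℝ}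
    {Θ₀ : Matrix (Fin q) (Fin p) ℝ} {Λ₀ : Matrix (Fin p) (Fin p) ℝ} (hSig : Sig.PosDef)
    (hΛ₀ : Λ₀.PosDef) (hΘ₀ : Θ₀ ≠ 0) : 0 < betaZero Sig Θ₀ Λ₀ := by
  have hM : 0 < lamMax Λ₀ := (lamMin_pos hp hΛ₀).trans_le (lamMin_le_lamMax hp hΛ₀.1)
  have hm := lamMin_pos hp (hΛ₀.smul (by norm_num : (0 : ℝ) < 3))
  have hT := lamTheta_pos hSig hΘ₀
  have hσ₁ := lamMin_pos hq hSig
  have h1 : 0 < min (lamMax Λ₀)⁻¹ (lamMin Sig) := lt_min (by positivity) hσ₁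
  have h2 : 0 < min 1 (lamMin ((3 : ℝ) • Λ₀) / (16 * lamTheta Sig Θ₀)) :=
    lt_min one_pos (by positivity)
  unfold betaZero rhoOne
  positivity

/-- Every point of the high posterior density region is within `ε_n` of the truth. -/
lemma frob_sub_le_epsRate (hp : 0 < p) (hq : 0 < q) (hn : 0 < n)
    {Sig : Matrix (Fin q) (Fin q) ℝ}
    {Θ₀ Θ : Matrix (Fin q) (Fin p) ℝ} {Λ₀ Λ : Matrix (Fin p) (Fin p) ℝ} (hSig : Sig.PosDef)
    (hΛ₀ : Λ₀.PosDef) (hΛ : Λ.PosDef) (hΘ₀ : Θ₀ ≠ 0) {ρ η ν₀ ν₁ K₀ : ℝ} (hρ : 0 ≤ ρ) (hρ1 : ρ ≤ 1)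
    (hη : 0 ≤ η) (hη1 : η ≤ 1) (h₀ : 0 < ν₀) (h : ν₀ ≤ ν₁) (hK₀ : 0 < K₀)
    (hν₀ : 1 / ((n : ℝ) * ν₀) ≤ K₀ * Real.sqrt (Real.log ((p : ℝ) + (q : ℝ)) / (n : ℝ)))
    (hε : frob Λ₀⁻¹ * epsRate (30 * K₀) n Sig Θ₀ Λ₀ < 1)
    {x : Fin n → Fin q → ℝ} {y : Fin n → Fin p → ℝ} (hdata : DataConditions ν₀ ν₁ x y Sig Θ₀ Λ₀)
    (hpost : negLogPost ρ η ν₀ ν₁ x y Θ Λ ≤ negLogPost ρ η ν₀ ν₁ x y Θ₀ Λ₀) :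
    frob (Θ - Θ₀) ≤ epsRate (30 * K₀) n Sig Θ₀ Λ₀ ∧
      frob (Λ - Λ₀) ≤ epsRate (30 * K₀) n Sig Θ₀ Λ₀ := by
  have h₁ : 0 < ν₁ := h₀.trans_le h
  have hn' : (0 : ℝ) < n := by exact_mod_cast hn
  have hβ := betaZero_pos hp hq hSig hΛ₀ hΘ₀
  set ε := epsRate (30 * K₀) n Sig Θ₀ Λ₀ with hεdef
  have hε0 : 0 ≤ ε := by
    rw [hεdef, epsRate]
    positivity
  set r := Real.sqrt (frob (Θ - Θ₀) ^ 2 + frob (Λ - Λ₀) ^ 2) with hr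
  have hr0 : 0 ≤ r := Real.sqrt_nonneg _
  have hr2 : r ^ 2 = frob (Θ - Θ₀) ^ 2 + frob (Λ - Λ₀) ^ 2 := Real.sq_sqrt (by positivity)
  have htr : frob (Θ - Θ₀) ≤ r := Real.le_sqrt_of_sq_le (by nlinarith [sq_nonneg (frob (Λ - Λ₀))])
  have hlr : frob (Λ - Λ₀) ≤ r := Real.le_sqrt_of_sq_le (by nlinarith [sq_nonneg (frob (Θ - Θ₀))])
  suffices r ≤ ε from ⟨htr.trans this, hlr.trans this⟩
  set D := likDiv (empMoment x x) Θ₀ Θ Λ₀ Λ with hD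
  have hbasic := likDiv_le_of_negLogPost_le hρ hρ1 hη hη1 h₀ h hΛ₀ hΛ hdata.2 hpost
  rw [← hD] at hbasic
  have hV : 0 < 1 + frob Λ₀⁻¹ * frob (Λ - Λ₀) := by
    have := mul_nonneg (frob_nonneg Λ₀⁻¹) (frob_nonneg (Λ - Λ₀))
    linarith
  have hD0 : 0 ≤ D := likDiv_nonneg hp hΛ₀ hΛ x Θ₀ Θ
  have hoff0 : 0 ≤ offSupport Θ₀ Θ := by
    unfold offSupport
    positivity
  have hon0 : 0 ≤ onSupport Θ₀ Θ Λ₀ Λ := by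
    unfold onSupport
    positivity
  have hcone : offSupport Θ₀ Θ ≤ coneAlpha ν₀ ν₁ * onSupport Θ₀ Θ Λ₀ Λ := by
    have h1 : 1 / (2 * ν₁) * offSupport Θ₀ Θ
        ≤ 1 / (2 * ν₁) * (coneAlpha ν₀ ν₁ * onSupport Θ₀ Θ Λ₀ Λ) := by
      have h2 : 1 / (2 * ν₁) * (coneAlpha ν₀ ν₁ * onSupport Θ₀ Θ Λ₀ Λ)
          = (1 / ν₀ + 1 / (2 * ν₁)) * onSupport Θ₀ Θ Λ₀ Λ := by
        unfold coneAlpha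
        field_simp
        ring
      have : 0 ≤ (n : ℝ) / 2 * D := by positivity
      linarith
    exact le_of_mul_le_mul_left h1 (by positivity)
  have hcurv := lik_curvature hp hq hSig hΛ₀ hΛ hΘ₀ h₀ h₁ hdata.1 hcone
  rw [← hD, ← hr2] at hcurv
  -- the upper bound on the divergence
  have hup : D ≤ betaZero Sig Θ₀ Λ₀ / 10 * ε * r := by
    have h1 : 1 / (2 * ν₁) ≤ 1 / ν₀ / 2 := by
      rw [div_div, mul_comm ν₀]
      gcongr
    have h2 : (n : ℝ) / 2 * D ≤ 3 / 2 * (1 / ν₀) * onSupport Θ₀ Θ Λ₀ Λ := by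
      have h3 : 0 ≤ 1 / (2 * ν₁) * offSupport Θ₀ Θ := by positivity
      have h4 := mul_le_mul_of_nonneg_right h1 hon0
      linarith
    have h3 : D ≤ 3 * (1 / (n * ν₀)) * onSupport Θ₀ Θ Λ₀ Λ := by
      calc D = 2 / n * ((n : ℝ) / 2 * D) := by field_simp
        _ ≤ 2 / n * (3 / 2 * (1 / ν₀) * onSupport Θ₀ Θ Λ₀ Λ) := by gcongr
        _ = _ := by field_simp
    have h4 : betaZero Sig Θ₀ Λ₀ / 10 * ε = 3 * (K₀
        * Real.sqrt (Real.log ((p : ℝ) + (q : ℝ)) / (n : ℝ))) * Real.sqrt (sRow Θ₀ Λ₀) := by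
      rw [hεdef, epsRate, mul_div_assoc (sRow Θ₀ Λ₀ : ℝ), Real.sqrt_mul (Nat.cast_nonneg _)]
      field_simp
      ring
    rw [h4, mul_assoc _ (Real.sqrt (sRow Θ₀ Λ₀ : ℝ))]
    refine h3.trans ?_
    gcongr
    exact onSupport_le Θ₀ Θ Λ₀ Λ
  -- quadratic lower and linear upper bound meet; `‖Λ₀⁻¹‖_F ε < 1` makes the factor `V` harmless
  rcases hr0.eq_or_lt with h5 | h5
  · rw [← h5]; exact hε0
  have h6 : betaZero Sig Θ₀ Λ₀ / 5 * r ^ 2 ≤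
      (1 + frob Λ₀⁻¹ * r) * (betaZero Sig Θ₀ Λ₀ / 10 * ε * r) := by
    refine hcurv.trans ?_
    have := frob_nonneg Λ₀⁻¹
    gcongr
  have h7 : betaZero Sig Θ₀ Λ₀ * r * (2 * r) ≤
      betaZero Sig Θ₀ Λ₀ * r * (ε + frob Λ₀⁻¹ * ε * r) := by nlinarith
  have h8 := le_of_mul_le_mul_left h7 (by positivity)
  have h9 : frob Λ₀⁻¹ * ε * r ≤ 1 * r := by gcongr
  linarith

/-! ### The plug-in estimator -/

lemma frob_coefB_sub_le {Θ₀ Θ : Matrix (Fin q) (Fin p) ℝ} {Λ₀ Λ : Matrix (Fin p) (Fin p) ℝ}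
    (hΛ₀ : Λ₀.PosDef) (hΛ : Λ.PosDef) {ε : ℝ} (hε : frob Λ₀⁻¹ * ε < 1)
    (hΘε : frob (Θ - Θ₀) ≤ ε) (hΛε : frob (Λ - Λ₀) ≤ ε) :
    frob (coefB Θ Λ - coefB Θ₀ Λ₀) ≤
      frob Λ₀⁻¹ * ε / (1 - frob Λ₀⁻¹ * ε) * (1 + frob Λ₀⁻¹ * frob Θ₀) := by
  have hε0 : 0 ≤ ε := (frob_nonneg _).trans hΘε
  have hF := frob_nonneg Λ₀⁻¹
  have hN := frob_nonneg Λ⁻¹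
  have hT := frob_nonneg Θ₀
  have hdiff : Λ⁻¹ - Λ₀⁻¹ = -(Λ⁻¹ * (Λ - Λ₀) * Λ₀⁻¹) := by
    rw [Matrix.inv_sub_inv (iff_of_true hΛ.isUnit hΛ₀.isUnit), ← neg_sub Λ Λ₀, Matrix.mul_neg,
      Matrix.neg_mul]
  have h1 : frob (Λ⁻¹ - Λ₀⁻¹) ≤ frob Λ⁻¹ * ε * frob Λ₀⁻¹ := by
    rw [hdiff, frob_neg]
    refine (frob_mul_le _ _).trans ?_
    gcongr
    refine (frob_mul_le _ _).trans ?_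
    gcongr
  have h2 : frob Λ⁻¹ ≤ frob Λ₀⁻¹ / (1 - frob Λ₀⁻¹ * ε) := by
    rw [le_div_iff₀ (by linarith)]
    have := frob_add_le (Λ⁻¹ - Λ₀⁻¹) Λ₀⁻¹
    rw [sub_add_cancel] at this
    linarith
  have h3 : coefB Θ Λ - coefB Θ₀ Λ₀ = -(Λ⁻¹ * (Θ - Θ₀)ᵀ + (Λ⁻¹ - Λ₀⁻¹) * Θ₀ᵀ) := by
    rw [coefB, coefB, transpose_sub, Matrix.mul_sub, Matrix.sub_mul]
    abel
  rw [h3, frob_neg]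
  calc frob (Λ⁻¹ * (Θ - Θ₀)ᵀ + (Λ⁻¹ - Λ₀⁻¹) * Θ₀ᵀ)
      ≤ frob Λ⁻¹ * ε + frob Λ⁻¹ * ε * frob Λ₀⁻¹ * frob Θ₀ := by
        refine (frob_add_le _ _).trans (add_le_add ?_ ?_)
        · refine (frob_mul_le _ _).trans ?_
          rw [frob_transpose]
          gcongr
        · refine (frob_mul_le _ _).trans ?_
          rw [frob_transpose]
          gcongr
    _ = frob Λ⁻¹ * (ε * (1 + frob Λ₀⁻¹ * frob Θ₀)) := by ring
    _ ≤ frob Λ₀⁻¹ / (1 - frob Λ₀⁻¹ * ε) * (ε * (1 + frob Λ₀⁻¹ * frob Θ₀)) := by gcongr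
    _ = _ := by ring

end GCRF

theorem corollary2 (K₀ K₁ : ℝ) (hK₀ : 0 < K₀) (hK₁ : 0 < K₁) :
    ∃ C : ℝ, 0 < C ∧
      ∀ (p q n : ℕ), 0 < p → 0 < q →
      ∀ (Sig : Matrix (Fin q) (Fin q) ℝ) (Θ₀ : Matrix (Fin q) (Fin p) ℝ)
        (Λ₀ : Matrix (Fin p) (Fin p) ℝ), Sig.PosDef → Λ₀.PosDef → Θ₀ ≠ 0 →
      -- hyperparameters
      ∀ (ρ η ν₀ ν₁ R : ℝ), 0 ≤ ρ → ρ ≤ 1 → 0 ≤ η → η ≤ 1 → 0 < ν₀ → ν₀ ≤ ν₁ →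
      1 / ((n : ℝ) * ν₀) ≤ K₀ * Real.sqrt (Real.log ((p : ℝ) + (q : ℝ)) / (n : ℝ)) →
      1 / ((n : ℝ) * ν₁) ≤ K₁ * Real.sqrt (Real.log ((p : ℝ) + (q : ℝ)) / (n : ℝ)) →
      R < 2 * GCRF.lamMax Λ₀ * Real.sqrt (GCRF.rZero Sig Θ₀ Λ₀)
        / GCRF.epsRate C n Sig Θ₀ Λ₀ →
      -- sample size
      ∀ (ε₁ : ℝ), 0 < ε₁ → ε₁ < 1 →
      ((p : ℝ) + (GCRF.sZero ν₀ ν₁ Sig Θ₀ Λ₀ : ℝ)) * Real.log ((p : ℝ) + (q : ℝ)) / ε₁ < (n : ℝ) →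
      -- the right-hand side of the bound is meaningful
      GCRF.frob Λ₀⁻¹ * GCRF.epsRate C n Sig Θ₀ Λ₀ < 1 →
      -- the data
      ∀ (Ω : Type*) [MeasurableSpace Ω] (μ : Measure Ω) [IsProbabilityMeasure μ]
        (X : Fin n → Ω → Fin q → ℝ) (Y : Fin n → Ω → Fin p → ℝ),
      GCRF.IsSample μ X Y Sig Θ₀ Λ₀ →
      ∀ (ε₀ : ℝ), 0 < ε₀ → ε₀ < 1 →
      -- data conditions with probability greater than `1 - ε₀`: so is the bound
      (μ {ω | ¬ GCRF.DataConditions ν₀ ν₁ (fun i => X i ω) (fun i => Y i ω) Sig Θ₀ Λ₀}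
            < ENNReal.ofReal ε₀ →
        μ {ω | ¬ GCRF.PlugInBound ρ η ν₀ ν₁ R (GCRF.epsRate C n Sig Θ₀ Λ₀)
              (fun i => X i ω) (fun i => Y i ω) Θ₀ Λ₀}
            < ENNReal.ofReal ε₀) ∧
      -- conditionally on the data conditions, the bound has probability greater than `1 - ε₀`
      (μ {ω | GCRF.DataConditions ν₀ ν₁ (fun i => X i ω) (fun i => Y i ω) Sig Θ₀ Λ₀} ≠ 0 →
        μ {ω | GCRF.DataConditions ν₀ ν₁ (fun i => X i ω) (fun i => Y i ω) Sig Θ₀ Λ₀ ∧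
            ¬ GCRF.PlugInBound ρ η ν₀ ν₁ R (GCRF.epsRate C n Sig Θ₀ Λ₀)
              (fun i => X i ω) (fun i => Y i ω) Θ₀ Λ₀}
            < ENNReal.ofReal ε₀ *
              μ {ω | GCRF.DataConditions ν₀ ν₁ (fun i => X i ω) (fun i => Y i ω) Sig Θ₀ Λ₀}) := by
  -- with `C = 30 K₀` the slope `3 K₀ √(|S⁰_row| log (p + q) / n)` of the upper bound on the
  -- divergence is `β₀ ε_n / 10`, half of the curvature `β₀ / 5` times `ε_n`
  refine ⟨30 * K₀, by positivity, ?_⟩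
  intro p q n hp hq Sig Θ₀ Λ₀ hSig hΛ₀ hΘ₀ ρ η ν₀ ν₁ R hρ hρ1 hη hη1 h₀ h hν₀ _ _ ε₁ hε₁ _ hsize hε
    Ω _ μ _ X Y _ ε₀ hε₀ _
  have hn : 0 < n := by
    have hlog : 0 ≤ Real.log ((p : ℝ) + (q : ℝ)) := by
      have := Real.log_natCast_nonneg (p + q)
      push_cast at this
      exact this
    have h1 : (0 : ℝ) ≤ ((p : ℝ) + (GCRF.sZero ν₀ ν₁ Sig Θ₀ Λ₀ : ℝ))
      * Real.log ((p : ℝ) + (q : ℝ)) / ε₁ := by positivity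
    exact_mod_cast h1.trans_lt hsize
  have key : ∀ ω, GCRF.DataConditions ν₀ ν₁ (fun i => X i ω) (fun i => Y i ω) Sig Θ₀ Λ₀ →
      GCRF.PlugInBound ρ η ν₀ ν₁ R (GCRF.epsRate (30 * K₀) n Sig Θ₀ Λ₀)
        (fun i => X i ω) (fun i => Y i ω) Θ₀ Λ₀ := by
    rintro ω hω ⟨Θ, Λ⟩ ⟨hΛ, -, hpost⟩
    obtain ⟨h1, h2⟩ := GCRF.frob_sub_le_epsRate hp hq hn hSig hΛ₀ hΛ hΘ₀ hρ hρ1 hη hη1 h₀ h hK₀ hν₀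
      hε hω hpost
    exact GCRF.frob_coefB_sub_le hΛ₀ hΛ hε h1 h2
  refine ⟨fun hD => lt_of_le_of_lt (measure_mono fun ω => mt (key ω)) hD, fun hD => ?_⟩
  have hempty : {ω | GCRF.DataConditions ν₀ ν₁ (fun i => X i ω) (fun i => Y i ω) Sig Θ₀ Λ₀ ∧
      ¬ GCRF.PlugInBound ρ η ν₀ ν₁ R (GCRF.epsRate (30 * K₀) n Sig Θ₀ Λ₀)
        (fun i => X i ω) (fun i => Y i ω) Θ₀ Λ₀} = ∅ :=
    Set.eq_empty_iff_forall_notMem.2 fun ω hω => hω.2 (key ω hω.1)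
  rw [hempty, measure_empty]
  exact ENNReal.mul_pos (ENNReal.ofReal_pos.2 hε₀).ne' hD
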